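/- Let $d\ge 1$. A $d$-uniform clutter $\mathcal C$ consists of a finite vertex set $V(\mathcal C)$ and a set of $d$-element subsets of $V(\mathcal C)$, called circuits. For a finite set $A$, the complete $d$-uniform clutter $\mathcal C_{A,d}$ has vertex set $A$ and all $d$-subsets of $A$ as circuits (so if $|A|<d$ it has no circuits, only isolated vertices). The generalized chordal clutters (Emtander) are the $d$-uniform clutters obtained inductively as follows: (a) every complete clutter $\mathcal C_{A,d}$ is generalized chordal; (b) if $\mathcal G$ is generalized chordal and $A$ is a finite set such that $|V(\mathcal G)\cap A|<|A|$ and every $d$-subset of $V(\mathcal G)\cap A$ is a circuit of $\mathcal G$, then $\mathcal G\cup\mathcal C_{A,d}$, with vertex set $V(\mathcal G)\cup A$, is generalized chordal; (c) if $\mathcal G$ is generalized chordal and $F\subset V(\mathcal G)$ is a set with $|F|=d$ having a $(d-1)$-subset that is contained in no circuit of $\mathcal G$, then $\mathcal G\cup\{F\}$, with vertex set $V(\mathcal G)$, is generalized chordal. For a field $K$, the circuit ideal of $\mathcal C$ is the ideal $I(\overline{\mathcal C})$ of $S=K[x_v : v\in V(\mathcal C)]$ generated by the monomials $\prod_{v\in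 T}x_v$, where $T$ runs over the $d$-subsets of $V(\mathcal C)$ that are not circuits of $\mathcal C$. A nonzero homogeneous ideal $I\subset S$ has a $d$-linear resolution if $\operatorname{reg}(I)=d=\operatorname{indeg}(I)$, where $\operatorname{indeg}(I)$ is the least degree of a nonzero homogeneous element of $I$ and $\operatorname{reg}(I)=\sup\{j-i : \beta_{i,j}(I)\neq 0\}$; here $\beta_{i,j}(I)$ is the number of summands $S(-j)$ in the $i$-th module of the minimal graded free resolution of $I$. **Theorem.** Let $\mathcal C$ be a generalized chordal $d$-uniform clutter and let $K$ be any field. If the circuit ideal $I(\overline{\mathcal C})$ is nonzero (that is, if $\mathcal C$ is not complete), then it has a $d$-linear resolution. -/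

import Mathlib

/-- A `d`-uniform clutter: a finite vertex set together with a finite set of circuits, each of
which is a set of exactly `d` vertices. (Distinct sets of equal size are never nested, so the
clutter condition is automatic.) Isolated vertices are allowed. -/
@[ext]
structure UniformClutter (α : Type*) (d : ℕ) where
  /-- the vertex set -/
  verts : Finset α
  /-- the set of circuits -/
  circuits : Finset (Finset α)
  subset_verts : ∀ F ∈ circuits, F ⊆ verts
  card_eq : ∀ F ∈ circuits, F.card = d

namespace UniformClutter

variable {α : Type*} [DecidableEq α] {d : ℕ}

/-- The maximal (complete) `d`-uniform clutter on the vertex set `A`. If `A` has fewer than `d`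
elements it has no circuits, i.e. it consists of isolated vertices. -/
def complete (d : ℕ) (A : Finset α) : UniformClutter α d where
  verts := A
  circuits := A.powersetCard d
  subset_verts _ hF := (Finset.mem_powersetCard.1 hF).1
  card_eq _ hF := (Finset.mem_powersetCard.1 hF).2

/-- The union of two `d`-uniform clutters (both on vertices from `α`). -/
def union (C₁ C₂ : UniformClutter α d) : UniformClutter α d where
  verts := C₁.verts ∪ C₂.verts
  circuits := C₁.circuits ∪ C₂.circuits
  subset_verts F hF := (Finset.mem_union.1 hF).elim
    (fun h => (C₁.subset_verts F h).trans Finset.subset_union_left)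
    (fun h => (C₂.subset_verts F h).trans Finset.subset_union_right)
  card_eq F hF := (Finset.mem_union.1 hF).elim (C₁.card_eq F) (C₂.card_eq F)

/-- The clutter `C ∪ {F}` for a set `F` of `d` vertices of `C`. -/
def addCircuit (C : UniformClutter α d) (F : Finset α) (hF : F ⊆ C.verts) (hd : F.card = d) :
    UniformClutter α d where
  verts := C.verts
  circuits := insert F C.circuits
  subset_verts G hG := (Finset.mem_insert.1 hG).elim (fun h => h ▸ hF) (C.subset_verts G)
  card_eq G hG := (Finset.mem_insert.1 hG).elim (fun h => h ▸ hd) (C.card_eq G)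

/-- The complement: same vertices, and the `d`-subsets of the vertex set that are not circuits. -/
def compl (C : UniformClutter α d) : UniformClutter α d where
  verts := C.verts
  circuits := C.verts.powersetCard d \ C.circuits
  subset_verts _ hF := (Finset.mem_powersetCard.1 (Finset.mem_sdiff.1 hF).1).1
  card_eq _ hF := (Finset.mem_powersetCard.1 (Finset.mem_sdiff.1 hF).1).2

/-- A set of vertices is a clique if all its `d`-subsets are circuits. -/
def IsClique (C : UniformClutter α d) (W : Finset α) : Prop :=
  W ⊆ C.verts ∧ ∀ F ⊆ W, F.card = d → F ∈ C.circuits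

/-- Generalized chordal clutters in the sense of Emtander. -/
inductive IsGeneralizedChordal : UniformClutter α d → Prop
  /-- complete clutters are generalized chordal -/
  | complete (A : Finset α) : IsGeneralizedChordal (UniformClutter.complete d A)
  /-- A complete clutter on a set `A` may be glued to `G` along a complete clutter: the common
  vertices of `G` and `A` form a clique of `G` with fewer elements than `A`. -/
  | glue (G : UniformClutter α d) (A : Finset α) (hG : IsGeneralizedChordal G)
      (hclique : G.IsClique (G.verts ∩ A)) (hlt : (G.verts ∩ A).card < A.card) :
      IsGeneralizedChordal (G.union (UniformClutter.complete d A))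
  /-- A `d`-set of vertices may be added as a circuit if it has a `(d-1)`-subset that lies in no
  circuit so far. -/
  | addCircuit (G : UniformClutter α d) (F : Finset α) (hG : IsGeneralizedChordal G)
      (hF : F ⊆ G.verts) (hd : F.card = d)
      (hfree : ∃ e ⊆ F, e.card + 1 = d ∧ ∀ F' ∈ G.circuits, ¬ e ⊆ F') :
      IsGeneralizedChordal (G.addCircuit F hF hd)

/-- The square-free monomial ideal of `K[x_v : v ∈ V]` generated by the monomials
`x_T = ∏_{v ∈ T} x_v`, where `T` runs over a family `E` of subsets of `V`. -/
noncomputable def monomialIdeal (K : Type*) [Field K] (V : Finset α) (E : Finset (Finset α)) :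
    Ideal (MvPolynomial {v // v ∈ V} K) :=
  Ideal.span {f | ∃ T ∈ E, f = ∏ v ∈ T.subtype (fun v => v ∈ V), MvPolynomial.X v}

/-- The circuit ideal of `C`: the ideal of `K[x_v : v a vertex of C]` generated by the monomials
that belong to the circuits of the complement of `C`. -/
noncomputable def circuitIdeal (K : Type*) [Field K] (C : UniformClutter α d) :
    Ideal (MvPolynomial {v // v ∈ C.verts} K) :=
  monomialIdeal K C.verts C.compl.circuits

end UniformClutter

/-- Let `F = ⊕_c S(-deg c)` be a graded free module over the polynomial ring `S` with homogeneous
basis indexed by `ι`. An element `x` of `F` is homogeneous of degree `j` if each nonzero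
coordinate `x c` is a homogeneous polynomial of degree `j - deg c`. -/
def IsHomogeneousElement {σ K ι : Type*} [Field K] (deg : ι → ℕ) (x : ι →₀ MvPolynomial σ K)
    (j : ℕ) : Prop :=
  ∀ c, x c = 0 ∨ ∃ n, n + deg c = j ∧ (x c).IsHomogeneous n

/-- A minimal graded free resolution `⋯ → F₂ → F₁ → F₀ → I → 0` of an ideal `I` of the
standard graded polynomial ring `S = K[x_s : s ∈ σ]`. The module `F i` is free of finite rank,
with a homogeneous basis indexed by `ι i`, the basis element `b` having degree `deg i b`. -/
structure MinimalGradedFreeResolution {σ K : Type*} [Field K]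
    (I : Ideal (MvPolynomial σ K)) where
  /-- index set of the basis of `F i` -/
  ι : ℕ → Type
  finite : ∀ i, Finite (ι i)
  /-- degrees of the basis elements -/
  deg : ∀ i, ι i → ℕ
  /-- the augmentation `F 0 → I ⊆ S` -/
  aug : (ι 0 →₀ MvPolynomial σ K) →ₗ[MvPolynomial σ K] MvPolynomial σ K
  /-- the differentials `F (i + 1) → F i` -/
  diff : ∀ i, (ι (i + 1) →₀ MvPolynomial σ K) →ₗ[MvPolynomial σ K] (ι i →₀ MvPolynomial σ K)
  /-- the augmentation preserves degrees -/
  aug_graded : ∀ b, (aug (Finsupp.single b 1)).IsHomogeneous (deg 0 b)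
  /-- the differentials preserve degrees -/
  diff_graded : ∀ i b,
    IsHomogeneousElement (deg i) (diff i (Finsupp.single b 1)) (deg (i + 1) b)
  /-- `F 0` maps onto `I` -/
  range_aug : LinearMap.range aug = I
  exact_zero : Function.Exact (diff 0) aug
  exact_succ : ∀ i, Function.Exact (diff (i + 1)) (diff i)
  /-- minimality: the image of each differential lies in `𝔪 F i`, with `𝔪 = (x_s : s ∈ σ)` -/
  minimal : ∀ i x c, MvPolynomial.constantCoeff (diff i x c) = 0

/-- The graded Betti number `β_{i,j}`: the number of summands `S(-j)` in `F i`. -/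
noncomputable def MinimalGradedFreeResolution.betti {σ K : Type*} [Field K]
    {I : Ideal (MvPolynomial σ K)} (F : MinimalGradedFreeResolution I) (i j : ℕ) : ℕ :=
  Nat.card {b : F.ι i // F.deg i b = j}

/-- `reg I = r`, where `reg I = sup {j - i : β_{i,j}(I) ≠ 0}` and the `β_{i,j}` are read off from
a minimal graded free resolution of `I` (which is unique up to isomorphism). No `r : ℤ` is a
supremum of the empty set, so this never holds for the zero ideal. -/
def HasRegularity {σ K : Type*} [Field K] (I : Ideal (MvPolynomial σ K)) (r : ℤ) : Prop :=
  ∃ F : MinimalGradedFreeResolution I,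
    IsLUB {m : ℤ | ∃ i j : ℕ, F.betti i j ≠ 0 ∧ m = (j : ℤ) - (i : ℤ)} r

/-- `indeg I = d`: the least degree of a nonzero homogeneous element of `I` is `d`. -/
def HasInitialDegree {σ K : Type*} [Field K] (I : Ideal (MvPolynomial σ K)) (d : ℕ) : Prop :=
  IsLeast {j : ℕ | ∃ f ∈ I, f ≠ 0 ∧ f.IsHomogeneous j} d

/-- The ideal `I` has a `d`-linear resolution: `reg I = d = indeg I`. -/
def HasLinearResolution {σ K : Type*} [Field K] (I : Ideal (MvPolynomial σ K)) (d : ℕ) : Prop :=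
  HasRegularity I d ∧ HasInitialDegree I d

-- Call a graded S-module M d-linear if M_d generates it and the kernel of S ⊗_K M_d → M is
-- (d+1)-linear, to every finite depth; zero is d-linear for all d. Let 0 → M → N → P → 0 be exact.
-- Flatness over K and the snake lemma show that N is d-linear if M and P are
-- (`Hom.isLinearUpTo_of_exact`). If N is d-linear and M is (d+1)-linear, then P is d-linear: N_d =
-- P_d, so the syzygies of P are an extension of M by those of N (`Hom.isLinearUpTo_of_exact_succ`).
-- Direct summands inherit linearity. For monomial ideals these facts are applied to 0 → I ∩ J → I ⊕
-- J → I + J → 0.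
--
-- Gluing adds the vertices of A outside G one at a time (`isLinearFamily_glue_aux`). If the new
-- vertex a is joined to a clique, the ideal I becomes I + x_a J, where J is generated by the
-- (d-1)-sets not inside the clique. For d ≥ 2 one has I ⊆ J, so I ∩ x_a J = x_a I is (d+1)-linear
-- and the sum is d-linear.
--
-- For a new circuit F with free face e (`isLinearFamily_addCircuit`), let I' be the new ideal and J
-- the ideal of all x_e x_v with v ∉ e. Then I' + J is the old ideal and I' ∩ J is x_e times the
-- ideal of the x_w with w ∉ F. Both are d-linear, hence so are I' ⊕ J and its summand I'.
--
-- Finally the modules S ⊗ (Syz_i)_{d+i} form a minimal resolution whose matrices have linear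
-- entries (`linearResolution`).

universe u v

open TensorProduct

/-! ### Graded modules and linearity -/

/-- A module over the polynomial ring `K[x_s : s ∈ σ]`, with `K`-linear projections `proj d` onto
its graded pieces. -/
structure GradedPolyModule (σ : Type u) (K : Type v) [Field K] where
  /-- the underlying module -/
  carrier : Type (max u v)
  [addCommGroup : AddCommGroup carrier]
  [moduleField : Module K carrier]
  [moduleRing : Module (MvPolynomial σ K) carrier]
  [tower : IsScalarTower K (MvPolynomial σ K) carrier]
  /-- the projection onto the piece of degree `d` -/
  proj : ℕ → carrier →ₗ[K] carrier
  proj_proj : ∀ d m, proj d (proj d m) = proj d m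
  proj_smul : ∀ d j (s : MvPolynomial σ K) m, proj d m = m →
    proj j (s • m) = if d ≤ j then MvPolynomial.homogeneousComponent (j - d) s • m else 0

theorem MvPolynomial.homogeneousComponent_mul_of_isHomogeneous {σ : Type*} {R : Type*}
    [CommSemiring R] {d : ℕ} {f : MvPolynomial σ R} (hf : f.IsHomogeneous d) (j : ℕ)
    (s : MvPolynomial σ R) :
    homogeneousComponent j (s * f) =
      if d ≤ j then homogeneousComponent (j - d) s * f else 0 := by
  let _ := MvPolynomial.gradedAlgebra (σ := σ) (R := R)
  have key (p : MvPolynomial σ R) (i : ℕ) :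
      (DirectSum.decompose (homogeneousSubmodule σ R) p i : MvPolynomial σ R) =
        homogeneousComponent i p := decomposition.decompose'_apply p i
  rw [← key, DirectSum.coe_decompose_mul_of_right_mem (homogeneousSubmodule σ R) j hf, key]

namespace GradedPolyModule

variable {σ : Type u} {K : Type v} [Field K]

attribute [instance] addCommGroup moduleField moduleRing tower

instance : CoeSort (GradedPolyModule σ K) (Type (max u v)) := ⟨carrier⟩

/-- The graded piece of degree `d`. -/
def piece (M : GradedPolyModule σ K) (d : ℕ) : Submodule K M :=
  LinearMap.eqLocus (M.proj d) LinearMap.id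

theorem mem_piece {M : GradedPolyModule σ K} {d : ℕ} {m : M} : m ∈ M.piece d ↔ M.proj d m = m :=
  LinearMap.mem_eqLocus

theorem proj_mem_piece (M : GradedPolyModule σ K) (d : ℕ) (m : M) : M.proj d m ∈ M.piece d :=
  mem_piece.2 (M.proj_proj d m)

/-- The canonical map `S ⊗ M_d → M`. -/
noncomputable def mulMap (M : GradedPolyModule σ K) (d : ℕ) :
    MvPolynomial σ K ⊗[K] M.piece d →ₗ[MvPolynomial σ K] M :=
  LinearMap.liftBaseChange (MvPolynomial σ K) (M.piece d).subtype

@[simp] theorem mulMap_tmul (M : GradedPolyModule σ K) (d : ℕ) (s : MvPolynomial σ K)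
    (v : M.piece d) : M.mulMap d (s ⊗ₜ v) = s • (v : M) := by
  simp [mulMap]

/-- `M` is generated by its elements of degree `d`. -/
def IsGeneratedIn (M : GradedPolyModule σ K) (d : ℕ) : Prop :=
  Function.Surjective (M.mulMap d)

/-- The projections of `S ⊗ V`, where `V` sits in degree `d`. -/
noncomputable def freeProj (V : Type*) [AddCommGroup V] [Module K V] (d j : ℕ) :
    MvPolynomial σ K ⊗[K] V →ₗ[K] MvPolynomial σ K ⊗[K] V :=
  if d ≤ j then LinearMap.rTensor V (MvPolynomial.homogeneousComponent (j - d)) else 0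

section
variable (V : Type*) [AddCommGroup V] [Module K V]

theorem freeProj_tmul (d j : ℕ) (s : MvPolynomial σ K) (v : V) :
    freeProj V d j (s ⊗ₜ[K] v) =
      if d ≤ j then MvPolynomial.homogeneousComponent (j - d) s ⊗ₜ[K] v else 0 := by
  unfold freeProj
  split_ifs <;> simp

theorem freeProj_freeProj (d j : ℕ) (t : MvPolynomial σ K ⊗[K] V) :
    freeProj V d j (freeProj V d j t) = freeProj V d j t := by
  induction t with
  | zero => simp
  | add x y hx hy => simp only [map_add, hx, hy]
  | tmul s v =>
    rw [freeProj_tmul]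
    split_ifs with h
    · rw [freeProj_tmul, if_pos h, MvPolynomial.homogeneousComponent_eq_self
        (MvPolynomial.homogeneousComponent_isHomogeneous _ _)]
    · simp

theorem freeProj_smul (d e j : ℕ) (s : MvPolynomial σ K) (t : MvPolynomial σ K ⊗[K] V)
    (ht : freeProj V d e t = t) :
    freeProj V d j (s • t) =
      if e ≤ j then MvPolynomial.homogeneousComponent (j - e) s • t else 0 := by
  -- Writing t as its own projection frees the claim from the hypothesis, so that it becomes
  -- additive in an arbitrary tensor.
  rw [← ht]
  generalize t = u
  induction u with
  | zero => simp
  | add x y hx hy =>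
    simp only [map_add, smul_add, hx, hy]
    split_ifs <;> simp
  | tmul a v =>
    rw [freeProj_tmul]
    by_cases hde : d ≤ e
    · rw [if_pos hde, smul_tmul', smul_tmul', freeProj_tmul, smul_eq_mul, smul_eq_mul,
        MvPolynomial.homogeneousComponent_mul_of_isHomogeneous
          (MvPolynomial.homogeneousComponent_isHomogeneous _ _)]
      by_cases hej : e ≤ j
      · rw [if_pos (hde.trans hej), if_pos (by omega), if_pos hej,
          show j - d - (e - d) = j - e by omega]
      · rw [if_neg hej]
        split_ifs
        · omega
        · simp
        · rfl
    · simp [if_neg hde]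
end

theorem mulMap_freeProj (M : GradedPolyModule σ K) (d j : ℕ)
    (t : MvPolynomial σ K ⊗[K] M.piece d) :
    M.mulMap d (freeProj _ d j t) = M.proj j (M.mulMap d t) := by
  induction t with
  | zero => simp
  | add x y hx hy => simp only [map_add, hx, hy]
  | tmul s v =>
    rw [freeProj_tmul, mulMap_tmul, M.proj_smul d j s v (mem_piece.1 v.2)]
    split_ifs <;> simp

/-- The kernel of `S ⊗ M_d → M`. -/
noncomputable def syz (M : GradedPolyModule σ K) (d : ℕ) : GradedPolyModule σ K where
  carrier := LinearMap.ker (M.mulMap d)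
  proj j := (freeProj (M.piece d) d j).restrict
    (p := (LinearMap.ker (M.mulMap d)).restrictScalars K)
    (q := (LinearMap.ker (M.mulMap d)).restrictScalars K) (fun x hx => by
      have hx' : M.mulMap d x = 0 := hx
      change M.mulMap d _ = 0
      rw [mulMap_freeProj, hx', map_zero])
  proj_proj j m := Subtype.ext (freeProj_freeProj _ _ _ _)
  proj_smul e j s m h := by
    have h1 := freeProj_smul (M.piece d) d e j s m.1 (congrArg Subtype.val h)
    refine Subtype.ext (h1.trans ?_)
    split_ifs <;> rfl

theorem syz_proj_val (M : GradedPolyModule σ K) (d j : ℕ) (x : M.syz d) :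
    ((M.syz d).proj j x).1 = freeProj (M.piece d) d j x.1 := rfl

/-- `M` is generated in degree `d`, and its first `k` syzygy modules are generated in degrees
`d + 1, …, d + k`. -/
def IsLinearUpTo : ℕ → ℕ → GradedPolyModule σ K → Prop
  | 0, d, M => M.IsGeneratedIn d
  | k + 1, d, M => M.IsGeneratedIn d ∧ IsLinearUpTo k (d + 1) (M.syz d)

theorem IsLinearUpTo.isGeneratedIn {k d : ℕ} {M : GradedPolyModule σ K}
    (h : IsLinearUpTo k d M) : M.IsGeneratedIn d := by
  cases k with
  | zero => exact h
  | succ k => exact h.1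

theorem IsLinearUpTo.of_succ {k : ℕ} : ∀ {d : ℕ} {M : GradedPolyModule σ K},
    IsLinearUpTo (k + 1) d M → IsLinearUpTo k d M := by
  induction k with
  | zero => exact fun h => h.1
  | succ k ih => exact fun h => ⟨h.1, ih h.2⟩

/-- `M` has a linear resolution, with generators in degree `d`. -/
def IsLinear (d : ℕ) (M : GradedPolyModule σ K) : Prop := ∀ k, IsLinearUpTo k d M

theorem IsGeneratedIn.proj_eq_zero {M : GradedPolyModule σ K} {d j : ℕ} (h : M.IsGeneratedIn d)
    (hj : j < d) (m : M) : M.proj j m = 0 := by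
  obtain ⟨t, rfl⟩ := h m
  rw [← mulMap_freeProj, freeProj, if_neg (by omega)]
  simp

/-! ### Linearity in short exact sequences -/

/-- An `S`-linear map carrying degree `d + j` to degree `e + j` for all `j ≥ 0`. -/
structure Hom (d e : ℕ) (M N : GradedPolyModule σ K) where
  /-- the underlying linear map -/
  toFun : M →ₗ[MvPolynomial σ K] N
  comm : ∀ j m, toFun (M.proj (d + j) m) = N.proj (e + j) (toFun m)

namespace Hom

variable {d e : ℕ} {M N P : GradedPolyModule σ K}

theorem mem_piece (f : Hom d e M N) {m : M} (hm : m ∈ M.piece d) : f.toFun m ∈ N.piece e := by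
  have h := f.comm 0 m
  rw [add_zero, add_zero, GradedPolyModule.mem_piece.1 hm] at h
  exact GradedPolyModule.mem_piece.2 h.symm

theorem mem_piece_of_injective (f : Hom d e M N) (hf : Function.Injective f.toFun) {m : M}
    (hm : f.toFun m ∈ N.piece e) : m ∈ M.piece d := by
  have h := f.comm 0 m
  rw [add_zero, add_zero, GradedPolyModule.mem_piece.1 hm] at h
  exact GradedPolyModule.mem_piece.2 (hf h)

/-- The map induced on the lowest graded pieces. -/
noncomputable def pieceMap (f : Hom d e M N) : M.piece d →ₗ[K] N.piece e :=
  (f.toFun.restrictScalars K).restrict fun _ h => f.mem_piece h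

@[simp] theorem pieceMap_val (f : Hom d e M N) (v : M.piece d) :
    (f.pieceMap v : N) = f.toFun v := rfl

theorem pieceMap_injective (f : Hom d e M N) (hf : Function.Injective f.toFun) :
    Function.Injective f.pieceMap := fun _ _ h =>
  Subtype.ext (hf (congrArg Subtype.val h))

theorem pieceMap_surjective (f : Hom d e M N) (hf : Function.Surjective f.toFun) :
    Function.Surjective f.pieceMap := fun w => by
  obtain ⟨m, hm⟩ := hf w
  -- Any preimage may be replaced by its component of degree d.
  refine ⟨⟨M.proj d m, M.proj_mem_piece d m⟩, Subtype.ext ?_⟩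
  have h := f.comm 0 m
  rw [add_zero, add_zero, hm, GradedPolyModule.mem_piece.1 w.2] at h
  exact h

theorem pieceMap_exact {c : ℕ} (f : Hom c d M N) (g : Hom d e N P)
    (hf : Function.Injective f.toFun) (h : Function.Exact f.toFun g.toFun) :
    Function.Exact f.pieceMap g.pieceMap := fun w => by
  constructor
  · intro hw
    obtain ⟨m, hm⟩ := (h w).1 (congrArg Subtype.val hw)
    exact ⟨⟨m, f.mem_piece_of_injective hf (hm ▸ w.2)⟩, Subtype.ext hm⟩
  · rintro ⟨m, rfl⟩
    exact Subtype.ext ((h _).2 ⟨m, rfl⟩)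

/-- The map `S ⊗ M_d → S ⊗ N_e` induced by a homomorphism. -/
noncomputable def freeMap (f : Hom d e M N) :
    MvPolynomial σ K ⊗[K] M.piece d →ₗ[MvPolynomial σ K] MvPolynomial σ K ⊗[K] N.piece e :=
  f.pieceMap.baseChange (MvPolynomial σ K)

theorem freeMap_tmul (f : Hom d e M N) (s : MvPolynomial σ K) (v : M.piece d) :
    f.freeMap (s ⊗ₜ[K] v) = s ⊗ₜ[K] f.pieceMap v := rfl

theorem mulMap_freeMap (f : Hom d e M N) (t : MvPolynomial σ K ⊗[K] M.piece d) :
    N.mulMap e (f.freeMap t) = f.toFun (M.mulMap d t) := by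
  induction t with
  | zero => simp
  | add x y hx hy => simp only [map_add, hx, hy]
  | tmul s v => simp [freeMap_tmul]

theorem freeMap_freeProj (f : Hom d e M N) (j : ℕ) (t : MvPolynomial σ K ⊗[K] M.piece d) :
    f.freeMap (freeProj _ d (d + j) t) = freeProj _ e (e + j) (f.freeMap t) := by
  induction t with
  | zero => simp
  | add x y hx hy => simp only [map_add, hx, hy]
  | tmul s v => simp [freeMap_tmul, freeProj_tmul]

theorem freeMap_injective (f : Hom d e M N) (hf : Function.Injective f.toFun) :
    Function.Injective f.freeMap :=
  Module.Flat.lTensor_preserves_injective_linearMap (M := MvPolynomial σ K) _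
    (f.pieceMap_injective hf)

theorem freeMap_surjective (f : Hom d e M N) (hf : Function.Surjective f.toFun) :
    Function.Surjective f.freeMap :=
  LinearMap.lTensor_surjective (MvPolynomial σ K) (f.pieceMap_surjective hf)

theorem freeMap_exact {c : ℕ} (f : Hom c d M N) (g : Hom d e N P)
    (hf : Function.Injective f.toFun) (h : Function.Exact f.toFun g.toFun) :
    Function.Exact f.freeMap g.freeMap :=
  Module.Flat.lTensor_exact (MvPolynomial σ K) (f.pieceMap_exact g hf h)

/-- The map induced on syzygies. -/
noncomputable def syzMap (f : Hom d e M N) : Hom (d + 1) (e + 1) (M.syz d) (N.syz e) where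
  toFun := f.freeMap.restrict fun x hx => by
    have hx' : M.mulMap d x = 0 := hx
    change N.mulMap e _ = 0
    rw [mulMap_freeMap, hx', map_zero]
  comm j m := Subtype.ext (by
    have h := f.freeMap_freeProj (1 + j) m.1
    rw [← add_assoc, ← add_assoc] at h
    exact h)

theorem syzMap_val (f : Hom d e M N) (x : M.syz d) : (f.syzMap.toFun x).1 = f.freeMap x.1 := rfl

theorem syzMap_injective (f : Hom d e M N) (hf : Function.Injective f.toFun) :
    Function.Injective f.syzMap.toFun := fun _ _ h =>
  Subtype.ext (f.freeMap_injective hf (congrArg Subtype.val h))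

/-- Left part of the snake lemma: a lift to S ⊗ M_c is itself a syzygy because M → N is injective.
-/
theorem syzMap_exact {c : ℕ} (f : Hom c d M N) (g : Hom d e N P)
    (hf : Function.Injective f.toFun) (h : Function.Exact f.toFun g.toFun) :
    Function.Exact f.syzMap.toFun g.syzMap.toFun := fun y => by
  constructor
  · intro hy
    obtain ⟨x, hx⟩ := (freeMap_exact f g hf h y.1).1 (congrArg Subtype.val hy)
    have hx0 : M.mulMap c x = 0 := hf (by
      rw [← mulMap_freeMap, hx, map_zero]
      exact y.2)
    exact ⟨⟨x, hx0⟩, Subtype.ext hx⟩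
  · rintro ⟨x, rfl⟩
    exact Subtype.ext ((freeMap_exact f g hf h _).2 ⟨x.1, rfl⟩)

/-- Right part of the snake lemma: the obstruction to lifting a syzygy of P to one of N lies in the
cokernel of S ⊗ M_c → M, which vanishes. -/
theorem syzMap_surjective {c : ℕ} (f : Hom c d M N) (g : Hom d e N P)
    (hg : Function.Surjective g.toFun) (h : Function.Exact f.toFun g.toFun)
    (hM : M.IsGeneratedIn c) : Function.Surjective g.syzMap.toFun := fun z => by
  obtain ⟨y, hy⟩ := g.freeMap_surjective hg z.1
  have h0 : g.toFun (N.mulMap d y) = 0 := by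
    rw [← mulMap_freeMap, hy]
    exact z.2
  obtain ⟨m, hm⟩ := (h _).1 h0
  obtain ⟨x, rfl⟩ := hM m
  have h1 : N.mulMap d (y - f.freeMap x) = 0 := by
    rw [map_sub, mulMap_freeMap, hm, sub_self]
  refine ⟨⟨y - f.freeMap x, h1⟩, Subtype.ext ?_⟩
  change g.freeMap (y - f.freeMap x) = z.1
  rw [map_sub, hy]
  have : g.freeMap (f.freeMap x) = 0 := by
    clear hm h0 h1 hy
    induction x with
    | zero => simp
    | add x y hx hy => simp only [map_add, hx, hy, add_zero]
    | tmul s v =>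
      have : g.pieceMap (f.pieceMap v) = 0 := Subtype.ext ((h _).2 ⟨v.1, rfl⟩)
      rw [freeMap_tmul, freeMap_tmul, this, tmul_zero]
  rw [this, sub_zero]

theorem isGeneratedIn_of_surjective (f : Hom d e M N) (hf : Function.Surjective f.toFun)
    (hM : M.IsGeneratedIn d) : N.IsGeneratedIn e := fun n => by
  obtain ⟨m, rfl⟩ := hf n
  obtain ⟨t, rfl⟩ := hM m
  exact ⟨f.freeMap t, f.mulMap_freeMap t⟩

theorem isGeneratedIn_of_exact {c : ℕ} (f : Hom c d M N) (g : Hom d e N P)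
    (h : Function.Exact f.toFun g.toFun) (hg : Function.Surjective g.toFun)
    (hM : M.IsGeneratedIn c) (hP : P.IsGeneratedIn e) : N.IsGeneratedIn d := fun n => by
  obtain ⟨z, hz⟩ := hP (g.toFun n)
  obtain ⟨y, rfl⟩ := g.freeMap_surjective hg z
  obtain ⟨m, hm⟩ := (h (n - N.mulMap d y)).1 (by
    rw [map_sub, ← hz, mulMap_freeMap, sub_self])
  obtain ⟨x, rfl⟩ := hM m
  refine ⟨f.freeMap x + y, ?_⟩
  rw [map_add, mulMap_freeMap, hm, sub_add_cancel]

/-- Linearity up to a given step passes to extensions. -/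
theorem isLinearUpTo_of_exact (k : ℕ) : ∀ {c d e : ℕ} {M N P : GradedPolyModule σ K}
    (f : Hom c d M N) (g : Hom d e N P) (_ : Function.Injective f.toFun)
    (_ : Function.Exact f.toFun g.toFun) (_ : Function.Surjective g.toFun)
    (_ : IsLinearUpTo k c M) (_ : IsLinearUpTo k e P), IsLinearUpTo k d N := by
  induction k with
  | zero => exact fun f g _ h hg hM hP => isGeneratedIn_of_exact f g h hg hM hP
  | succ k ih =>
    exact fun f g hf h hg hM hP => ⟨isGeneratedIn_of_exact f g h hg hM.1 hP.1,
      ih f.syzMap g.syzMap (f.syzMap_injective hf) (syzMap_exact f g hf h)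
        (syzMap_surjective f g hg h hM.1) hM.2 hP.2⟩

/-- Linearity up to a given step passes to retracts. -/
theorem isLinearUpTo_of_retract (k : ℕ) : ∀ {d e : ℕ} {M N : GradedPolyModule σ K}
    (i : Hom d e M N) (r : Hom e d N M) (_ : ∀ m, r.toFun (i.toFun m) = m)
    (_ : IsLinearUpTo k e N), IsLinearUpTo k d M := by
  induction k with
  | zero =>
    exact fun i r hr hN => r.isGeneratedIn_of_surjective (fun m => ⟨_, hr m⟩) hN
  | succ k ih =>
    refine fun i r hr hN => ⟨r.isGeneratedIn_of_surjective (fun m => ⟨_, hr m⟩) hN.1,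
      ih i.syzMap r.syzMap (fun x => Subtype.ext ?_) hN.2⟩
    rw [syzMap_val, syzMap_val]
    generalize x.1 = t
    induction t with
    | zero => simp
    | add x y hx hy => simp only [map_add, hx, hy]
    | tmul s v =>
      rw [freeMap_tmul, freeMap_tmul, show r.pieceMap (i.pieceMap v) = v from Subtype.ext (hr _)]

/-- The quotient of a module with a linear resolution starting in degree `d` by a submodule with a
linear resolution starting in degree `d + 1` has a linear resolution starting in degree `d`. -/
theorem isLinearUpTo_of_exact_succ (k : ℕ) {d : ℕ} {M N P : GradedPolyModule σ K}
    (f : Hom d d M N) (g : Hom d d N P) (hf : Function.Injective f.toFun)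
    (h : Function.Exact f.toFun g.toFun) (hg : Function.Surjective g.toFun)
    (hM : IsLinearUpTo k (d + 1) M) (hN : IsLinearUpTo k d N) : IsLinearUpTo k d P := by
  have hP := g.isGeneratedIn_of_surjective hg hN.isGeneratedIn
  cases k with
  | zero => exact hP
  | succ k =>
    refine ⟨hP, ?_⟩
    -- M is generated in degree d + 1, so M_d = 0 and N_d → P_d loses nothing.
    have hinj : Function.Injective g.pieceMap := by
      rw [injective_iff_map_eq_zero]
      intro v hv
      obtain ⟨m, hm⟩ := (h v).1 (congrArg Subtype.val hv)
      have hm' : m ∈ M.piece d := f.mem_piece_of_injective hf (hm ▸ v.2)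
      have hm0 : m = 0 := by
        rw [← GradedPolyModule.mem_piece.1 hm']
        exact hM.isGeneratedIn.proj_eq_zero (Nat.lt_succ_self d) m
      exact Subtype.ext (by rw [← hm, hm0, map_zero]; rfl)
    have hbij : Function.Bijective g.freeMap :=
      ⟨Module.Flat.lTensor_preserves_injective_linearMap (M := MvPolynomial σ K) _ hinj,
        g.freeMap_surjective hg⟩
    let φ := (LinearEquiv.ofBijective g.freeMap hbij)
    let ψ := LinearEquiv.ofInjective f.toFun hf
    have hφ (z : P.syz d) : N.mulMap d (φ.symm z.1) ∈ LinearMap.range f.toFun := by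
      refine (h _).1 ?_
      rw [← mulMap_freeMap]
      have : g.freeMap (φ.symm z.1) = z.1 := φ.apply_symm_apply _
      rw [this]
      exact z.2
    -- The connecting map: a syzygy of P, read in S ⊗ N_d, is evaluated in N and lands in the image
    -- of M.
    let θ : P.syz d →ₗ[MvPolynomial σ K] M := ψ.symm.toLinearMap ∘ₗ
      (N.mulMap d ∘ₗ φ.symm.toLinearMap ∘ₗ (LinearMap.ker (P.mulMap d)).subtype).codRestrict
        (LinearMap.range f.toFun) hφ
    have hθ (z : P.syz d) : f.toFun (θ z) = N.mulMap d (φ.symm z.1) :=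
      congrArg Subtype.val (ψ.apply_symm_apply
        (⟨N.mulMap d (φ.symm z.1), hφ z⟩ : LinearMap.range f.toFun))
    have hφsymm (y) : φ.symm (g.freeMap y) = y := φ.symm_apply_apply y
    let θ' : Hom (d + 1) (d + 1) (P.syz d) M :=
      { toFun := θ
        comm := fun j z => hf (by
          obtain ⟨y, hy⟩ := hbij.2 z.1
          have h1 := f.comm (1 + j) (θ z)
          rw [← add_assoc] at h1
          rw [h1, hθ, hθ, syz_proj_val, ← hy, add_assoc, ← freeMap_freeProj, hφsymm, hφsymm,
            mulMap_freeProj]) }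
    -- The sequence 0 → Syz N → Syz P → M → 0, all of whose terms start in degree d + 1.
    refine isLinearUpTo_of_exact k g.syzMap θ' ?_ ?_ ?_ hN.2 hM.of_succ
    · exact fun x y hxy => Subtype.ext (hbij.1 (congrArg Subtype.val hxy))
    · intro z
      constructor
      · intro hz
        have h1 := hθ z
        rw [show θ z = 0 from hz, map_zero] at h1
        exact ⟨⟨φ.symm z.1, h1.symm⟩, Subtype.ext (φ.apply_symm_apply z.1)⟩
      · rintro ⟨y, rfl⟩
        refine hf ((hθ _).trans ?_)
        rw [syzMap_val, hφsymm, map_zero]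
        exact y.2
    · intro m
      obtain ⟨y, hy⟩ := hN.isGeneratedIn (f.toFun m)
      have hy' : P.mulMap d (g.freeMap y) = 0 := by
        rw [mulMap_freeMap, hy]
        exact (h _).2 ⟨m, rfl⟩
      refine ⟨⟨g.freeMap y, hy'⟩, hf ((hθ _).trans ?_)⟩
      rw [hφsymm, hy]

end Hom

/-- Lets empty families take part in the inductions, although the zero ideal has no regularity. -/
theorem isLinearUpTo_of_subsingleton (k : ℕ) : ∀ (d : ℕ) (M : GradedPolyModule σ K)
    [Subsingleton M], IsLinearUpTo k d M := by
  induction k with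
  | zero => exact fun d M _ m => ⟨0, Subsingleton.elim _ _⟩
  | succ k ih =>
    intro d M _
    refine ⟨fun m => ⟨0, Subsingleton.elim _ _⟩, ?_⟩
    have : Subsingleton (MvPolynomial σ K ⊗[K] M.piece d) := inferInstance
    have : Subsingleton (M.syz d) :=
      inferInstanceAs (Subsingleton (LinearMap.ker (M.mulMap d)))
    exact ih _ _

/-- The direct sum of graded modules. -/
noncomputable def prod (M N : GradedPolyModule σ K) : GradedPolyModule σ K where
  carrier := M × N
  proj j := (M.proj j).prodMap (N.proj j)
  proj_proj d m := Prod.ext (M.proj_proj d m.1) (N.proj_proj d m.2)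
  proj_smul d j s m h := by
    have h1 := M.proj_smul d j s m.1 (congrArg Prod.fst h)
    have h2 := N.proj_smul d j s m.2 (congrArg Prod.snd h)
    refine Prod.ext (h1.trans ?_) (h2.trans ?_) <;> split_ifs <;> rfl

theorem isLinearUpTo_prod {k d : ℕ} {M N : GradedPolyModule σ K} (hM : IsLinearUpTo k d M)
    (hN : IsLinearUpTo k d N) : IsLinearUpTo k d (M.prod N) := by
  let f : Hom d d M (M.prod N) := ⟨LinearMap.inl _ M N, fun j m => Prod.ext rfl (by
    exact (map_zero (N.proj (d + j))).symm)⟩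
  let g : Hom d d (M.prod N) N := ⟨LinearMap.snd _ M N, fun j m => rfl⟩
  refine Hom.isLinearUpTo_of_exact k f g ?_ ?_ ?_ hM hN
  · exact LinearMap.inl_injective
  · exact Function.Exact.inl_snd
  · exact LinearMap.snd_surjective

theorem isLinearUpTo_of_prod_left {k d : ℕ} {M N : GradedPolyModule σ K}
    (h : IsLinearUpTo k d (M.prod N)) : IsLinearUpTo k d M := by
  let f : Hom d d M (M.prod N) := ⟨LinearMap.inl _ M N, fun j m => Prod.ext rfl (by
    exact (map_zero (N.proj (d + j))).symm)⟩
  let g : Hom d d (M.prod N) M := ⟨LinearMap.fst _ M N, fun j m => rfl⟩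
  exact Hom.isLinearUpTo_of_retract k f g (fun _ => rfl) h

/-! ### Monomial ideals as graded modules -/

/-- The monomial ideal generated by the monomials with exponents in `P`. -/
noncomputable def exponentIdeal (K : Type v) [Field K] (P : Set (σ →₀ ℕ)) :
    Ideal (MvPolynomial σ K) :=
  Ideal.span ((fun m => MvPolynomial.monomial m 1) '' P)

theorem mem_exponentIdeal {P : Set (σ →₀ ℕ)} (hP : IsUpperSet P) {f : MvPolynomial σ K} :
    f ∈ exponentIdeal K P ↔ ∀ m ∈ f.support, m ∈ P := by
  rw [exponentIdeal, MvPolynomial.mem_ideal_span_monomial_image]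
  exact forall₂_congr fun m _ => ⟨fun ⟨n, hn, h⟩ => hP h hn, fun h => ⟨m, h, le_rfl⟩⟩

theorem homogeneousComponent_mem_exponentIdeal {P : Set (σ →₀ ℕ)} {f : MvPolynomial σ K}
    (hf : f ∈ exponentIdeal K P) (j : ℕ) :
    MvPolynomial.homogeneousComponent j f ∈ exponentIdeal K P := by
  rw [exponentIdeal, MvPolynomial.mem_ideal_span_monomial_image] at hf ⊢
  intro m hm
  rw [MvPolynomial.support_homogeneousComponent] at hm
  exact hf m (Finset.mem_filter.1 hm).1

/-- A monomial ideal as a graded module. -/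
noncomputable def ofExponents (K : Type v) [Field K] (P : Set (σ →₀ ℕ)) :
    GradedPolyModule σ K where
  carrier := exponentIdeal K P
  moduleField := Submodule.module' (exponentIdeal K P)
  tower := Submodule.isScalarTower (exponentIdeal K P)
  proj j := (MvPolynomial.homogeneousComponent j).restrict
    (p := (exponentIdeal K P).restrictScalars K) (q := (exponentIdeal K P).restrictScalars K)
    fun _ h => homogeneousComponent_mem_exponentIdeal h j
  proj_proj d m := Subtype.ext (MvPolynomial.homogeneousComponent_eq_self
    (MvPolynomial.homogeneousComponent_isHomogeneous _ _))
  proj_smul d j s m h := by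
    have hm : m.1.IsHomogeneous d := by
      have h' : MvPolynomial.homogeneousComponent d m.1 = m.1 := congrArg Subtype.val h
      rw [← h']
      exact MvPolynomial.homogeneousComponent_isHomogeneous _ _
    refine Subtype.ext
      ((MvPolynomial.homogeneousComponent_mul_of_isHomogeneous hm j s).trans ?_)
    split_ifs <;> rfl

theorem ofExponents_proj_val (P : Set (σ →₀ ℕ)) (j : ℕ) (f : ofExponents K P) :
    ((ofExponents K P).proj j f).1 = MvPolynomial.homogeneousComponent j f.1 := rfl

theorem mem_piece_ofExponents {P : Set (σ →₀ ℕ)} {d : ℕ} {f : ofExponents K P} :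
    f ∈ (ofExponents K P).piece d ↔ f.1.IsHomogeneous d := by
  rw [mem_piece]
  refine ⟨fun h => ?_, fun h => Subtype.ext (MvPolynomial.homogeneousComponent_eq_self h)⟩
  have h' : MvPolynomial.homogeneousComponent d f.1 = f.1 := congrArg Subtype.val h
  rw [← h']
  exact MvPolynomial.homogeneousComponent_isHomogeneous _ _

theorem isLinear_ofExponents_empty (d : ℕ) : IsLinear d (ofExponents K (∅ : Set (σ →₀ ℕ))) := by
  intro k
  have : Subsingleton (ofExponents K (∅ : Set (σ →₀ ℕ))) := by
    refine ⟨fun x y => Subtype.ext ?_⟩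
    have h (z : ofExponents K (∅ : Set (σ →₀ ℕ))) : z.1 = 0 := by
      have := z.2
      simpa only [exponentIdeal, Set.image_empty, Ideal.span_empty, Submodule.mem_bot] using this
    rw [h x, h y]
  exact isLinearUpTo_of_subsingleton k d _

/-- The ideal is S itself, free on 1, so its syzygies vanish. -/
theorem isLinear_ofExponents_of_zero_mem {P : Set (σ →₀ ℕ)} (hP : 0 ∈ P) :
    IsLinear 0 (ofExponents K P) := by
  have h1 : (1 : MvPolynomial σ K) ∈ exponentIdeal K P := Ideal.subset_span ⟨0, hP, rfl⟩
  let one : (ofExponents K P).piece 0 :=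
    ⟨⟨1, h1⟩, mem_piece_ofExponents.2 (MvPolynomial.isHomogeneous_one σ K)⟩
  have hmul (s : MvPolynomial σ K) : ((ofExponents K P).mulMap 0 (s ⊗ₜ one)).1 = s := by
    rw [mulMap_tmul]
    exact mul_one s
  have hgen : (ofExponents K P).IsGeneratedIn 0 := fun f => ⟨f.1 ⊗ₜ one, Subtype.ext (hmul _)⟩
  -- The piece of degree 0 is K · 1, so every tensor is pure.
  have hone (t : MvPolynomial σ K ⊗[K] (ofExponents K P).piece 0) : ∃ s, t = s ⊗ₜ one := by
    induction t with
    | zero => exact ⟨0, (zero_tmul _ _).symm⟩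
    | add x y hx hy =>
      obtain ⟨s, rfl⟩ := hx
      obtain ⟨t, rfl⟩ := hy
      exact ⟨s + t, (add_tmul _ _ _).symm⟩
    | tmul s v =>
      have hv : v = (MvPolynomial.coeff 0 v.1.1) • one := by
        refine Subtype.ext (Subtype.ext ?_)
        have h := congrArg Subtype.val (mem_piece.1 v.2)
        rw [ofExponents_proj_val, MvPolynomial.homogeneousComponent_zero] at h
        refine h.symm.trans ?_
        change _ = (MvPolynomial.coeff 0 v.1.1) • (1 : MvPolynomial σ K)
        rw [MvPolynomial.smul_eq_C_mul, mul_one]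
      refine ⟨(MvPolynomial.coeff 0 v.1.1) • s, ?_⟩
      rw [smul_tmul, ← hv]
  have : Subsingleton ((ofExponents K P).syz 0) := by
    refine ⟨fun x y => Subtype.ext ?_⟩
    have h (z : (ofExponents K P).syz 0) : z.1 = 0 := by
      obtain ⟨s, hs⟩ := hone z.1
      have hz : (ofExponents K P).mulMap 0 z.1 = 0 := z.2
      have := hmul s
      rw [← hs, hz] at this
      rw [hs, ← this]
      exact zero_tmul _ _
    rw [h x, h y]
  intro k
  cases k with
  | zero => exact hgen
  | succ k => exact ⟨hgen, isLinearUpTo_of_subsingleton k _ _⟩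

/-! ### The Mayer–Vietoris sequence of two monomial ideals -/

section Union

variable {A B : Set (σ →₀ ℕ)}

theorem exponentIdeal_mono (h : A ⊆ B) : exponentIdeal K A ≤ exponentIdeal K B :=
  Ideal.span_mono (Set.image_mono h)

/-- The inclusion of monomial ideals. -/
noncomputable def inclusionHom (d : ℕ) (h : A ⊆ B) :
    Hom d d (ofExponents K A) (ofExponents K B) where
  toFun := Submodule.inclusion (exponentIdeal_mono h)
  comm _ _ := rfl

/-- The diagonal map `I_{A ∩ B} → I_A ⊕ I_B`. -/
noncomputable def interHom (K : Type v) [Field K] (A B : Set (σ →₀ ℕ)) (d : ℕ) :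
    Hom d d (ofExponents K (A ∩ B)) ((ofExponents K A).prod (ofExponents K B)) where
  toFun := LinearMap.prod (inclusionHom d Set.inter_subset_left).toFun
    (inclusionHom d Set.inter_subset_right).toFun
  comm _ _ := rfl

/-- The difference map `I_A ⊕ I_B → I_{A ∪ B}`. -/
noncomputable def unionHom (K : Type v) [Field K] (A B : Set (σ →₀ ℕ)) (d : ℕ) :
    Hom d d ((ofExponents K A).prod (ofExponents K B)) (ofExponents K (A ∪ B)) where
  toFun := LinearMap.coprod (inclusionHom d Set.subset_union_left).toFun
    (-(inclusionHom d Set.subset_union_right).toFun)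
  comm j m := by
    change _ + - _ = (ofExponents K (A ∪ B)).proj (d + j) (_ + - _)
    rw [map_add, map_neg]
    rfl

theorem interHom_injective (d : ℕ) : Function.Injective (interHom K A B d).toFun := fun x y h => by
  have h' : ((interHom K A B d).toFun x).1.1 = ((interHom K A B d).toFun y).1.1 := by rw [h]
  exact Subtype.ext h'

theorem unionHom_val (d : ℕ) (x : (ofExponents K A).prod (ofExponents K B)) :
    ((unionHom K A B d).toFun x).1 = x.1.1 - x.2.1 := (sub_eq_add_neg _ _).symm

theorem unionHom_surjective (d : ℕ) : Function.Surjective (unionHom K A B d).toFun := fun f => by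
  have hf : f.1 ∈ exponentIdeal K A ⊔ exponentIdeal K B := by
    rw [exponentIdeal, exponentIdeal, ← Ideal.span_union, ← Set.image_union]
    exact f.2
  obtain ⟨a, ha, b, hb, h⟩ := Submodule.mem_sup.1 hf
  refine ⟨(⟨a, ha⟩, ⟨-b, neg_mem hb⟩), Subtype.ext ((unionHom_val _ _).trans ?_)⟩
  rw [← h]
  exact sub_neg_eq_add a b

theorem interHom_unionHom_exact (hA : IsUpperSet A) (hB : IsUpperSet B) (d : ℕ) :
    Function.Exact (interHom K A B d).toFun (unionHom K A B d).toFun := fun x => by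
  constructor
  · intro hx
    have h : x.1.1 = x.2.1 := by
      have h := congrArg Subtype.val hx
      rw [unionHom_val] at h
      exact sub_eq_zero.1 h
    have h' : x.1.1 ∈ exponentIdeal K (A ∩ B) := (mem_exponentIdeal (hA.inter hB)).2 fun m hm =>
      ⟨(mem_exponentIdeal hA).1 x.1.2 m hm, (mem_exponentIdeal hB).1 x.2.2 m (h ▸ hm)⟩
    exact ⟨⟨x.1.1, h'⟩, Prod.ext rfl (Subtype.ext h)⟩
  · rintro ⟨y, rfl⟩
    exact Subtype.ext ((unionHom_val _ _).trans (sub_self _))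

theorem isLinear_ofExponents_union {d : ℕ} (hA : IsUpperSet A) (hB : IsUpperSet B)
    (hlA : IsLinear d (ofExponents K A)) (hlB : IsLinear d (ofExponents K B))
    (hN : IsLinear (d + 1) (ofExponents K (A ∩ B))) :
    IsLinear d (ofExponents K (A ∪ B)) := fun k =>
  Hom.isLinearUpTo_of_exact_succ k (interHom K A B d) (unionHom K A B d) (interHom_injective d)
    (interHom_unionHom_exact hA hB d) (unionHom_surjective d) (hN k)
    (isLinearUpTo_prod (hlA k) (hlB k))

/-- The direct sum of the two ideals is an extension of d-linear modules, and I_A is a summand of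
it. -/
theorem isLinear_ofExponents_left {d : ℕ} (hA : IsUpperSet A) (hB : IsUpperSet B)
    (hN : IsLinear d (ofExponents K (A ∩ B))) (hU : IsLinear d (ofExponents K (A ∪ B))) :
    IsLinear d (ofExponents K A) := fun k =>
  isLinearUpTo_of_prod_left (Hom.isLinearUpTo_of_exact k (interHom K A B d) (unionHom K A B d)
    (interHom_injective d) (interHom_unionHom_exact hA hB d) (unionHom_surjective d) (hN k)
    (hU k))

end Union

/-! ### Multiplication by a variable -/

theorem mul_X_mem_exponentIdeal {P : Set (σ →₀ ℕ)} (a : σ) {f : MvPolynomial σ K}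
    (hf : f ∈ exponentIdeal K P) :
    f * MvPolynomial.X a ∈ exponentIdeal K ((· + Finsupp.single a 1) '' P) := by
  classical
  rw [exponentIdeal, MvPolynomial.mem_ideal_span_monomial_image] at hf ⊢
  intro m hm
  rw [MvPolynomial.support_mul_X, Finset.mem_map] at hm
  obtain ⟨n, hn, rfl⟩ := hm
  obtain ⟨p, hp, hpn⟩ := hf n hn
  exact ⟨_, ⟨p, hp, rfl⟩, add_le_add_left hpn _⟩

theorem isUpperSet_image_add {P : Set (σ →₀ ℕ)} (hP : IsUpperSet P) (e : σ →₀ ℕ) :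
    IsUpperSet ((· + e) '' P) := by
  rintro _ n h ⟨m, hm, rfl⟩
  obtain ⟨c, rfl⟩ := exists_add_of_le h
  exact ⟨m + c, hP le_self_add hm, add_right_comm _ _ _⟩

/-- Multiplication by a variable as a map of monomial ideals. -/
noncomputable def mulXHom (K : Type v) [Field K] (P : Set (σ →₀ ℕ)) (a : σ) (d : ℕ) :
    Hom d (d + 1) (ofExponents K P) (ofExponents K ((· + Finsupp.single a 1) '' P)) where
  toFun := (LinearMap.mulRight (MvPolynomial σ K) (MvPolynomial.X a)).restrict
    fun _ h => mul_X_mem_exponentIdeal a h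
  comm j m := Subtype.ext (by
    refine Eq.trans ?_ (MvPolynomial.homogeneousComponent_mul_of_isHomogeneous
      (MvPolynomial.isHomogeneous_X K a) (d + 1 + j) m.1).symm
    rw [if_pos (by omega), show d + 1 + j - 1 = d + j by omega]
    rfl)

theorem mulXHom_bijective {P : Set (σ →₀ ℕ)} (hP : IsUpperSet P) (a : σ) (d : ℕ) :
    Function.Bijective (mulXHom K P a d).toFun := by
  constructor
  · intro f g h
    exact Subtype.ext (mul_right_cancel₀ (MvPolynomial.X_ne_zero a) (congrArg Subtype.val h))
  · intro g
    have hle : exponentIdeal K ((· + Finsupp.single a 1) '' P) ≤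
        Ideal.span {MvPolynomial.X a} := by
      refine Ideal.span_le.2 ?_
      rintro _ ⟨_, ⟨m, _, rfl⟩, rfl⟩
      refine Ideal.mem_span_singleton.2 ⟨MvPolynomial.monomial m 1, ?_⟩
      rw [mul_comm, MvPolynomial.X, MvPolynomial.monomial_mul, one_mul]
    obtain ⟨f, hf⟩ := Ideal.mem_span_singleton.1 (hle g.2)
    have hfP : f ∈ exponentIdeal K P := by
      rw [mem_exponentIdeal hP]
      intro m hm
      have hg : f * MvPolynomial.X a ∈ exponentIdeal K ((· + Finsupp.single a 1) '' P) := by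
        rw [mul_comm, ← hf]
        exact g.2
      obtain ⟨n, hn, h⟩ := (mem_exponentIdeal (isUpperSet_image_add hP _)).1 hg
        (m + Finsupp.single a 1) (by
          rw [MvPolynomial.support_mul_X]
          exact Finset.mem_map_of_mem _ hm)
      rwa [← add_right_cancel h]
    exact ⟨⟨f, hfP⟩, Subtype.ext ((mul_comm _ _).trans hf.symm)⟩

/-- Multiplication by x_a is an isomorphism raising degrees by one; its inverse exhibits the image
as a retract of the original ideal. -/
theorem isLinear_ofExponents_image_add {P : Set (σ →₀ ℕ)} (hP : IsUpperSet P) (a : σ) {d : ℕ}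
    (h : IsLinear d (ofExponents K P)) :
    IsLinear (d + 1) (ofExponents K ((· + Finsupp.single a 1) '' P)) := fun k => by
  let r := mulXHom K P a d
  let φ := LinearEquiv.ofBijective r.toFun (mulXHom_bijective hP a d)
  have hφ (x) : r.toFun (φ.symm x) = x := φ.apply_symm_apply x
  let i : Hom (d + 1) d (ofExponents K ((· + Finsupp.single a 1) '' P)) (ofExponents K P) :=
    { toFun := φ.symm.toLinearMap
      comm := fun j m => (mulXHom_bijective hP a d).1 (by
        refine (hφ _).trans (Eq.trans ?_ (r.comm j (φ.symm m)).symm)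
        rw [hφ]) }
  exact Hom.isLinearUpTo_of_retract k i r hφ (h k)

end GradedPolyModule

/-! ### Square-free ideals given by families of sets -/

section SquareFree

variable {α : Type u}

/-- The exponents of the monomials in `K[x_v : v ∈ U]` whose support contains a member of `E`. -/
def exponentsContaining (U : Finset α) (E : Set (Finset α)) : Set ({v // v ∈ U} →₀ ℕ) :=
  {m | ∃ T ∈ E, T ⊆ m.support.map (Function.Embedding.subtype _)}

theorem isUpperSet_exponentsContaining (U : Finset α) (E : Set (Finset α)) :
    IsUpperSet (exponentsContaining U E) := fun _ _ h ⟨T, hT, hTm⟩ =>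
  ⟨T, hT, hTm.trans (Finset.map_subset_map.2 (Finsupp.support_mono h))⟩

/-- The square-free monomial ideal of `K[x_v : v ∈ U]` generated by the family `E` has a linear
resolution with generators in degree `d`. -/
def IsLinearFamily (K : Type v) [Field K] (U : Finset α) (d : ℕ) (E : Set (Finset α)) : Prop :=
  GradedPolyModule.IsLinear d (GradedPolyModule.ofExponents K (exponentsContaining U E))

namespace IsLinearFamily

variable {K : Type v} [Field K] {U : Finset α} {d : ℕ}

theorem exponentsContaining_union (A B : Set (Finset α)) :
    exponentsContaining U (A ∪ B) = exponentsContaining U A ∪ exponentsContaining U B := by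
  ext m
  simp only [exponentsContaining, Set.mem_union, Set.mem_ofPred_eq, or_and_right, exists_or]

/-- Membership of a monomial depends only on its support, so an intersection of square-free ideals
can be tested on finite sets. -/
theorem exponentsContaining_inter {A B N : Set (Finset α)}
    (h : ∀ s, (∃ T ∈ N, T ⊆ s) ↔ (∃ T ∈ A, T ⊆ s) ∧ ∃ T ∈ B, T ⊆ s) :
    exponentsContaining U N = exponentsContaining U A ∩ exponentsContaining U B :=
  Set.ext fun _ => h _

theorem exponentsContaining_congr {A B : Set (Finset α)}
    (h : ∀ s, (∃ T ∈ A, T ⊆ s) ↔ ∃ T ∈ B, T ⊆ s) :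
    exponentsContaining U A = exponentsContaining U B :=
  Set.ext fun _ => h _

theorem empty (d : ℕ) : IsLinearFamily K U d ∅ := by
  have h : exponentsContaining U (∅ : Set (Finset α)) = ∅ := by
    ext m
    simp [exponentsContaining]
  rw [IsLinearFamily, h]
  exact GradedPolyModule.isLinear_ofExponents_empty d

theorem of_empty_mem {E : Set (Finset α)} (h : ∅ ∈ E) : IsLinearFamily K U 0 E :=
  GradedPolyModule.isLinear_ofExponents_of_zero_mem ⟨∅, h, Finset.empty_subset _⟩

theorem union {A B N : Set (Finset α)} (hA : IsLinearFamily K U d A)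
    (hB : IsLinearFamily K U d B) (hN : IsLinearFamily K U (d + 1) N)
    (h : ∀ s, (∃ T ∈ N, T ⊆ s) ↔ (∃ T ∈ A, T ⊆ s) ∧ ∃ T ∈ B, T ⊆ s) :
    IsLinearFamily K U d (A ∪ B) := by
  rw [IsLinearFamily, exponentsContaining_inter h] at hN
  rw [IsLinearFamily, exponentsContaining_union]
  exact GradedPolyModule.isLinear_ofExponents_union (isUpperSet_exponentsContaining U A)
    (isUpperSet_exponentsContaining U B) hA hB hN

theorem left_of_union {A B N W : Set (Finset α)} (hN : IsLinearFamily K U d N)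
    (hW : IsLinearFamily K U d W)
    (h : ∀ s, (∃ T ∈ N, T ⊆ s) ↔ (∃ T ∈ A, T ⊆ s) ∧ ∃ T ∈ B, T ⊆ s)
    (h' : ∀ s, (∃ T ∈ W, T ⊆ s) ↔ ∃ T ∈ A ∪ B, T ⊆ s) :
    IsLinearFamily K U d A := by
  rw [IsLinearFamily, exponentsContaining_inter h] at hN
  rw [IsLinearFamily, exponentsContaining_congr h', exponentsContaining_union] at hW
  exact GradedPolyModule.isLinear_ofExponents_left (isUpperSet_exponentsContaining U A)
    (isUpperSet_exponentsContaining U B) hN hW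

theorem exists_subset_card_not_subset {T B : Finset α} {k : ℕ} (hT : T.card = k + 2)
    (hTB : ¬ T ⊆ B) : ∃ R ⊆ T, R.card = k + 1 ∧ ¬ R ⊆ B := by
  obtain ⟨v, hv, hvB⟩ := Finset.not_subset.1 hTB
  obtain ⟨R, hvR, hRT, hR⟩ := Finset.exists_subsuperset_card_eq (s := {v}) (t := T) (n := k + 1)
    (Finset.singleton_subset_iff.2 hv) (by simp) (by omega)
  exact ⟨R, hRT, hR, fun h => hvB (h (Finset.singleton_subset_iff.1 hvR))⟩

variable [DecidableEq α]

/-- Since a lies in no member of E, the new ideal is x_a times the old one. -/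
theorem image_insert {E : Set (Finset α)} (hE : IsLinearFamily K U d E) {a : α} (ha : a ∈ U)
    (haE : ∀ T ∈ E, a ∉ T) : IsLinearFamily K U (d + 1) (insert a '' E) := by
  have h : exponentsContaining U (insert a '' E) =
      (· + Finsupp.single ⟨a, ha⟩ 1) '' exponentsContaining U E := by
    ext m
    constructor
    · rintro ⟨_, ⟨T, hT, rfl⟩, hTm⟩
      have ham : m ⟨a, ha⟩ ≠ 0 := by
        simpa [ha] using hTm (Finset.mem_insert_self a T)
      refine ⟨m - Finsupp.single ⟨a, ha⟩ 1, ⟨T, hT, fun v hv => ?_⟩, ?_⟩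
      · have hva : v ≠ a := fun h => haE T hT (h ▸ hv)
        obtain ⟨w, hw, rfl⟩ := Finset.mem_map.1 (hTm (Finset.mem_insert_of_mem hv))
        refine Finset.mem_map_of_mem _ ?_
        have hwa : (⟨a, ha⟩ : {v // v ∈ U}) ≠ w := fun h => hva (congrArg Subtype.val h).symm
        rw [Finsupp.mem_support_iff] at hw ⊢
        rwa [Finsupp.tsub_apply, Finsupp.single_eq_of_ne' hwa, tsub_zero]
      · refine tsub_add_cancel_of_le ?_
        rw [Finsupp.single_le_iff]
        omega
    · rintro ⟨n, ⟨T, hT, hTn⟩, rfl⟩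
      refine ⟨_, ⟨T, hT, rfl⟩, ?_⟩
      refine Finset.insert_subset ?_ ?_
      · simp [ha]
      · exact hTn.trans (Finset.map_subset_map.2 (Finsupp.support_mono le_self_add))
  rw [IsLinearFamily, h]
  exact GradedPolyModule.isLinear_ofExponents_image_add (isUpperSet_exponentsContaining U E) _ hE

theorem image_union {E : Set (Finset α)} (hE : IsLinearFamily K U d E) (e : Finset α)
    (he : e ⊆ U) (heE : ∀ T ∈ E, Disjoint e T) :
    IsLinearFamily K U (d + e.card) ((e ∪ ·) '' E) := by
  induction e using Finset.induction_on with
  | empty => simpa using hE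
  | insert a e ha ih =>
    rw [Finset.insert_subset_iff] at he
    have h := (ih he.2 fun T hT => (Finset.disjoint_insert_left.1 (heE T hT)).2).image_insert he.1
      (by
        rintro _ ⟨T, hT, rfl⟩
        have := (Finset.disjoint_insert_left.1 (heE T hT)).1
        simp [ha, this])
    rw [Set.image_image] at h
    rw [Finset.card_insert_of_notMem ha, ← add_assoc]
    simpa only [Finset.insert_union] using h

/-- Adjoining a vertex `a` whose link is the complement of the family `M`. -/
theorem union_image_insert {E M : Set (Finset α)} (hE : IsLinearFamily K U (d + 1) E)
    (hM : IsLinearFamily K U d M) {a : α} (ha : a ∈ U) (haE : ∀ T ∈ E, a ∉ T)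
    (haM : ∀ T ∈ M, a ∉ T) (hEM : ∀ T ∈ E, ∃ R ∈ M, R ⊆ T) :
    IsLinearFamily K U (d + 1) (E ∪ insert a '' M) := by
  -- The intersection is x_a I_E because I_E ⊆ I_M; it is linear one degree higher.
  refine hE.union (hM.image_insert ha haM) (hE.image_insert ha haE) fun s => ?_
  constructor
  · rintro ⟨_, ⟨T, hT, rfl⟩, hs⟩
    obtain ⟨R, hR, hRT⟩ := hEM T hT
    exact ⟨⟨T, hT, (Finset.subset_insert _ _).trans hs⟩,
      ⟨_, ⟨R, hR, rfl⟩, (Finset.insert_subset_insert a hRT).trans hs⟩⟩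
  · rintro ⟨⟨T, hT, hTs⟩, ⟨_, ⟨R, hR, rfl⟩, hs⟩⟩
    exact ⟨_, ⟨T, hT, rfl⟩, Finset.insert_subset (hs (Finset.mem_insert_self a R)) hTs⟩

/-- The family of all `k`-subsets of a set. -/
theorem card_eq (V : Finset α) (hV : V ⊆ U) (k : ℕ) :
    IsLinearFamily K U k {T | T ⊆ V ∧ T.card = k} := by
  induction V using Finset.induction_on generalizing k with
  | empty =>
    cases k with
    | zero => exact of_empty_mem ⟨subset_rfl, rfl⟩
    | succ k =>
      convert IsLinearFamily.empty (K := K) (U := U) (k + 1)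
      ext T
      simp only [Finset.subset_empty, Set.mem_ofPred_eq, Set.mem_empty_iff_false, iff_false]
      rintro ⟨rfl, h⟩
      simp at h
  | insert a V ha ih =>
    rw [Finset.insert_subset_iff] at hV
    cases k with
    | zero => exact of_empty_mem ⟨Finset.empty_subset _, rfl⟩
    | succ k =>
      have h := (ih hV.2 (k + 1)).union_image_insert (ih hV.2 k) hV.1
        (fun T hT h => ha (hT.1 h)) (fun T hT h => ha (hT.1 h)) (by
          rintro T ⟨hT, hTk⟩
          obtain ⟨R, hR, hRk⟩ := Finset.exists_subset_card_eq (s := T) (n := k) (by omega)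
          exact ⟨R, ⟨hR.trans hT, hRk⟩, hR⟩)
      convert h using 1
      ext T
      constructor
      · rintro ⟨hT, hTk⟩
        by_cases haT : a ∈ T
        · refine Or.inr ⟨T.erase a, ⟨?_, ?_⟩, Finset.insert_erase haT⟩
          · exact Finset.subset_insert_iff.1 hT
          · rw [Finset.card_erase_of_mem haT, hTk, Nat.add_sub_cancel]
        · exact Or.inl ⟨(Finset.subset_insert_iff_of_notMem haT).1 hT, hTk⟩
      · rintro (⟨hT, hTk⟩ | ⟨R, ⟨hR, hRk⟩, rfl⟩)
        · exact ⟨hT.trans (Finset.subset_insert _ _), hTk⟩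
        · exact ⟨Finset.insert_subset_insert a hR,
            by rw [Finset.card_insert_of_notMem fun h => ha (hR h), hRk]⟩

/-- Induction on W: a set containing the new vertex a is never inside B, so what remains after
deleting a is an arbitrary k-subset of B ∪ W. -/
theorem not_subset_aux (B W : Finset α) (hBW : Disjoint B W) (hU : B ∪ W ⊆ U) (k : ℕ) :
    IsLinearFamily K U k {T | T ⊆ B ∪ W ∧ T.card = k ∧ ¬ T ⊆ B} := by
  induction W using Finset.induction_on generalizing k with
  | empty =>
    convert IsLinearFamily.empty (K := K) (U := U) k
    ext T
    simp only [Finset.union_empty, Set.mem_ofPred_eq, Set.mem_empty_iff_false, iff_false]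
    exact fun h => h.2.2 h.1
  | insert a W ha ih =>
    rw [Finset.disjoint_insert_right] at hBW
    rw [Finset.union_insert, Finset.insert_subset_iff] at hU
    have haBW : a ∉ B ∪ W := by simp [ha, hBW.1]
    cases k with
    | zero =>
      convert IsLinearFamily.empty (K := K) (U := U) 0
      ext T
      simp only [Set.mem_ofPred_eq, Set.mem_empty_iff_false, iff_false]
      rintro ⟨_, h, h'⟩
      rw [Finset.card_eq_zero.1 h] at h'
      exact h' (Finset.empty_subset _)
    | succ k =>
      have h := (ih hBW.2 hU.2 (k + 1)).union_image_insert (card_eq (B ∪ W) hU.2 k) hU.1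
        (fun T hT h => haBW (hT.1 h)) (fun T hT h => haBW (hT.1 h)) (by
          rintro T ⟨hT, hTk, -⟩
          obtain ⟨R, hR, hRk⟩ := Finset.exists_subset_card_eq (s := T) (n := k) (by omega)
          exact ⟨R, ⟨hR.trans hT, hRk⟩, hR⟩)
      convert h using 1
      rw [Finset.union_insert]
      ext T
      constructor
      · rintro ⟨hT, hTk, hTB⟩
        by_cases haT : a ∈ T
        · refine Or.inr ⟨T.erase a, ⟨?_, ?_⟩, Finset.insert_erase haT⟩
          · exact Finset.subset_insert_iff.1 hT
          · rw [Finset.card_erase_of_mem haT, hTk, Nat.add_sub_cancel]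
        · exact Or.inl ⟨(Finset.subset_insert_iff_of_notMem haT).1 hT, hTk, hTB⟩
      · rintro (⟨hT, hTk, hTB⟩ | ⟨R, ⟨hR, hRk⟩, rfl⟩)
        · exact ⟨hT.trans (Finset.subset_insert _ _), hTk, hTB⟩
        · exact ⟨Finset.insert_subset_insert a hR,
            by rw [Finset.card_insert_of_notMem fun h => haBW (hR h), hRk],
            fun h => hBW.1 (h (Finset.mem_insert_self a R))⟩

/-- The family of all `k`-subsets of `V` that are not subsets of `B`. -/
theorem not_subset {B V : Finset α} (hBV : B ⊆ V) (hV : V ⊆ U) (k : ℕ) :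
    IsLinearFamily K U k {T | T ⊆ V ∧ T.card = k ∧ ¬ T ⊆ B} := by
  have h := not_subset_aux (K := K) (U := U) B (V \ B) Finset.disjoint_sdiff
    (by rwa [Finset.union_sdiff_of_subset hBV]) k
  rwa [Finset.union_sdiff_of_subset hBV] at h

end IsLinearFamily

/-! ### The operations that build generalized chordal clutters -/

namespace UniformClutter

variable [DecidableEq α] {d : ℕ}

/-- The circuits of the complement of `C`. -/
def nonCircuits (C : UniformClutter α d) : Set (Finset α) :=
  {T | T ⊆ C.verts ∧ T.card = d ∧ T ∉ C.circuits}

theorem mem_compl_circuits {C : UniformClutter α d} {T : Finset α} :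
    T ∈ C.compl.circuits ↔ T ∈ C.nonCircuits := by
  simp only [compl, nonCircuits, Finset.mem_sdiff, Finset.mem_powersetCard, and_assoc,
    Set.mem_ofPred_eq]

variable {K : Type v} [Field K] {U : Finset α}

/-- A non-circuit through the new vertex a is a together with a (d-1)-set not inside B ∪ W; such
sets form a linear family by `IsLinearFamily.not_subset`. Without new vertices, the condition on B
is automatic because B is a clique. -/
theorem isLinearFamily_glue_aux (hd : 0 < d) (C : UniformClutter α d) (B : Finset α)
    (hB : C.IsClique B) (hC : IsLinearFamily K U d C.nonCircuits) (W : Finset α)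
    (hW : Disjoint C.verts W) (hU : C.verts ∪ W ⊆ U) :
    IsLinearFamily K U d
      {T | T ⊆ C.verts ∪ W ∧ T.card = d ∧ T ∉ C.circuits ∧ ¬ T ⊆ B ∪ W} := by
  obtain ⟨k, rfl⟩ : ∃ k, d = k + 1 := ⟨d - 1, by omega⟩
  induction W using Finset.induction_on with
  | empty =>
    convert hC using 1
    ext T
    simp only [Finset.union_empty, nonCircuits, Set.mem_ofPred_eq]
    exact ⟨fun h => ⟨h.1, h.2.1, h.2.2.1⟩,
      fun h => ⟨h.1, h.2.1, h.2.2, fun hTB => h.2.2 (hB.2 T hTB h.2.1)⟩⟩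
  | insert a W ha ih =>
    rw [Finset.disjoint_insert_right] at hW
    rw [Finset.union_insert, Finset.insert_subset_iff] at hU
    have haV : a ∉ C.verts ∪ W := by simp [ha, hW.1]
    have hBW : B ∪ W ⊆ C.verts ∪ W := Finset.union_subset_union hB.1 subset_rfl
    have hE := ih hW.2 hU.2
    have hM := IsLinearFamily.not_subset (K := K) hBW hU.2 k
    have h : IsLinearFamily K U (k + 1)
        ({T | T ⊆ C.verts ∪ W ∧ T.card = k + 1 ∧ T ∉ C.circuits ∧ ¬ T ⊆ B ∪ W} ∪
          insert a '' {T | T ⊆ C.verts ∪ W ∧ T.card = k ∧ ¬ T ⊆ B ∪ W}) := by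
      -- For d = 1 the only candidate for a (d-1)-set is ∅, which lies in B ∪ W, so the vertex a
      -- contributes nothing. For larger d, a non-circuit outside the clique still has a
      -- (d-1)-subset outside it.
      cases k with
      | zero =>
        convert hE
        rw [Set.union_eq_left]
        rintro _ ⟨R, ⟨-, hR, hR'⟩, rfl⟩
        rw [Finset.card_eq_zero.1 hR] at hR'
        exact absurd (Finset.empty_subset _) hR'
      | succ k =>
        refine hE.union_image_insert hM hU.1 (fun T hT h => haV (hT.1 h))
          (fun T hT h => haV (hT.1 h)) ?_
        rintro T ⟨hT, hTk, -, hTB⟩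
        obtain ⟨R, hR, hRk, hRB⟩ := IsLinearFamily.exists_subset_card_not_subset hTk hTB
        exact ⟨R, ⟨hR.trans hT, hRk, hRB⟩, hR⟩
    convert h using 1
    rw [Finset.union_insert, Finset.union_insert]
    ext T
    constructor
    · rintro ⟨hT, hTk, hTC, hTB⟩
      by_cases haT : a ∈ T
      · refine Or.inr ⟨T.erase a, ⟨?_, ?_, fun h => hTB ?_⟩, Finset.insert_erase haT⟩
        · exact Finset.subset_insert_iff.1 hT
        · rw [Finset.card_erase_of_mem haT, hTk, Nat.add_sub_cancel]
        · exact Finset.subset_insert_iff.2 h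
      · exact Or.inl ⟨(Finset.subset_insert_iff_of_notMem haT).1 hT, hTk, hTC,
          fun h => hTB (h.trans (Finset.subset_insert _ _))⟩
    · rintro (⟨hT, hTk, hTC, hTB⟩ | ⟨R, ⟨hR, hRk, hRB⟩, rfl⟩)
      · exact ⟨hT.trans (Finset.subset_insert _ _), hTk, hTC, fun h => hTB
          ((Finset.subset_insert_iff_of_notMem fun h => haV (hT h)).1 h)⟩
      · have haR : a ∉ R := fun h => haV (hR h)
        exact ⟨Finset.insert_subset_insert a hR,
          by rw [Finset.card_insert_of_notMem haR, hRk],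
          fun h => hW.1 (C.subset_verts _ h (Finset.mem_insert_self a R)),
          fun h => hRB ((Finset.subset_insert_iff_of_notMem haR).1
            ((Finset.subset_insert a R).trans h))⟩

theorem isLinearFamily_glue (hd : 0 < d) (C : UniformClutter α d) (A : Finset α)
    (hA : C.IsClique (C.verts ∩ A)) (hC : IsLinearFamily K U d C.nonCircuits)
    (hU : C.verts ∪ A ⊆ U) :
    IsLinearFamily K U d (C.union (complete d A)).nonCircuits := by
  have h := isLinearFamily_glue_aux hd C _ hA hC (A \ C.verts) Finset.disjoint_sdiff
    (by rwa [Finset.union_sdiff_self_eq_union])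
  convert h using 1
  have h1 : C.verts ∩ A ∪ A \ C.verts = A := by
    rw [Finset.inter_comm, Finset.union_comm, Finset.sdiff_union_inter]
  rw [h1, Finset.union_sdiff_self_eq_union]
  ext T
  simp only [nonCircuits, union, complete, Finset.mem_union, Finset.mem_powersetCard,
    Set.mem_ofPred_eq]
  tauto

/-- Splitting off the whole star of e, rather than F alone, makes the intersection start in degree d
instead of d + 1, as the extension argument needs. -/
theorem isLinearFamily_addCircuit (C : UniformClutter α d) (F : Finset α) (hF : F ⊆ C.verts)
    (hd : F.card = d) (hfree : ∃ e ⊆ F, e.card + 1 = d ∧ ∀ F' ∈ C.circuits, ¬ e ⊆ F')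
    (hC : IsLinearFamily K U d C.nonCircuits) (hU : C.verts ⊆ U) :
    IsLinearFamily K U d (C.addCircuit F hF hd).nonCircuits := by
  obtain ⟨e, heF, hed, he⟩ := hfree
  have hstar : IsLinearFamily K U d ((e ∪ ·) '' {T | T ⊆ C.verts \ F ∧ T.card = 1}) := by
    have h := (IsLinearFamily.card_eq (K := K) (C.verts \ F) (Finset.sdiff_subset.trans hU)
      1).image_union e (heF.trans (hF.trans hU)) fun T hT =>
        (Finset.disjoint_sdiff.mono_left heF).mono_right hT.1
    rwa [add_comm, hed] at h
  have hadd (T : Finset α) : T ∈ (C.addCircuit F hF hd).nonCircuits ↔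
      T ∈ C.nonCircuits ∧ T ≠ F := by
    simp only [nonCircuits, addCircuit, Finset.mem_insert, Set.mem_ofPred_eq]
    tauto
  refine IsLinearFamily.left_of_union (B := (e ∪ ·) '' {T | T ⊆ C.verts \ e ∧ T.card = 1})
    hstar hC (fun s => ?_) (fun s => ?_)
  · constructor
    · rintro ⟨_, ⟨R, ⟨hR, hR1⟩, rfl⟩, hs⟩
      have heR : Disjoint e R := (Finset.disjoint_sdiff.mono_left heF).mono_right hR
      refine ⟨⟨e ∪ R, (hadd _).2 ⟨⟨?_, ?_, ?_⟩, ?_⟩, hs⟩, ⟨_, ⟨R, ⟨?_, hR1⟩, rfl⟩, hs⟩⟩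
      · exact Finset.union_subset (heF.trans hF) (hR.trans Finset.sdiff_subset)
      · rw [Finset.card_union_of_disjoint heR, hR1, hed]
      · exact fun h => he _ h Finset.subset_union_left
      · intro h
        obtain ⟨v, rfl⟩ := Finset.card_eq_one.1 hR1
        have hv := hR (Finset.mem_singleton_self v)
        refine (Finset.mem_sdiff.1 hv).2 ?_
        rw [← h]
        exact Finset.mem_union_right _ (Finset.mem_singleton_self v)
      · exact hR.trans (Finset.sdiff_subset_sdiff subset_rfl heF)
    · rintro ⟨⟨T, hT, hTs⟩, ⟨_, ⟨R, -, rfl⟩, hs⟩⟩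
      obtain ⟨hT, hTF⟩ := (hadd T).1 hT
      -- A non-circuit T ≠ F has a vertex w outside F, and e ∪ {w} is the required member of the
      -- smaller star.
      have : ¬ T ⊆ F := fun h => hTF (Finset.eq_of_subset_of_card_le h (by rw [hd, hT.2.1]))
      obtain ⟨w, hwT, hwF⟩ := Finset.not_subset.1 this
      refine ⟨_, ⟨{w}, ⟨?_, Finset.card_singleton w⟩, rfl⟩, ?_⟩
      · exact Finset.singleton_subset_iff.2 (Finset.mem_sdiff.2 ⟨hT.1 hwT, hwF⟩)
      · exact Finset.union_subset (Finset.subset_union_left.trans hs)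
          (Finset.singleton_subset_iff.2 (hTs hwT))
  · constructor
    · rintro ⟨T, hT, hTs⟩
      by_cases hTF : T = F
      · subst hTF
        refine ⟨T, Or.inr ⟨T \ e, ⟨Finset.sdiff_subset_sdiff hF subset_rfl, ?_⟩, ?_⟩, hTs⟩
        · rw [Finset.card_sdiff_of_subset heF]
          omega
        · exact Finset.union_sdiff_of_subset heF
      · exact ⟨T, Or.inl ((hadd T).2 ⟨hT, hTF⟩), hTs⟩
    · rintro ⟨T, (hT | ⟨R, ⟨hR, hR1⟩, rfl⟩), hTs⟩
      · exact ⟨T, ((hadd T).1 hT).1, hTs⟩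
      · refine ⟨e ∪ R, ⟨?_, ?_, fun h => he _ h Finset.subset_union_left⟩, hTs⟩
        · exact Finset.union_subset (heF.trans hF) (hR.trans Finset.sdiff_subset)
        · rw [Finset.card_union_of_disjoint (Finset.disjoint_sdiff.mono_right hR), hR1, hed]

/-- The complement of a generalized chordal clutter is a linear family. -/
theorem IsGeneralizedChordal.isLinearFamily (hd : 0 < d) {C : UniformClutter α d}
    (hC : C.IsGeneralizedChordal) (hU : C.verts ⊆ U) :
    IsLinearFamily K U d C.nonCircuits := by
  -- The polynomial ring on U stays fixed while the vertex set of the clutter grows.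
  induction hC with
  | complete A =>
    convert IsLinearFamily.empty (K := K) (U := U) d
    ext T
    simp only [nonCircuits, UniformClutter.complete, Finset.mem_powersetCard, Set.mem_ofPred_eq,
      Set.mem_empty_iff_false, iff_false]
    tauto
  | glue G A _ hclique _ ih =>
    exact isLinearFamily_glue hd G A hclique (ih (Finset.subset_union_left.trans hU)) hU
  | addCircuit G F _ hF hF' hfree ih =>
    exact isLinearFamily_addCircuit G F hF hF' hfree (ih hU) hU

/-- The exponent set on the right is closed upwards: it consists of all monomials divisible by a
generator, and these span the same ideal. -/
theorem circuitIdeal_eq (C : UniformClutter α d) :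
    C.circuitIdeal K =
      GradedPolyModule.exponentIdeal K (exponentsContaining C.verts C.nonCircuits) := by
  have hprod (T : Finset α) : ∏ v ∈ T.subtype (fun v => v ∈ C.verts),
      (MvPolynomial.X v : MvPolynomial {v // v ∈ C.verts} K) = MvPolynomial.monomial
        (∑ v ∈ T.subtype (fun v => v ∈ C.verts), Finsupp.single v 1) 1 := by
    rw [MvPolynomial.monomial_sum_one]
    rfl
  refine le_antisymm (Ideal.span_le.2 ?_) (Ideal.span_le.2 ?_)
  · rintro _ ⟨T, hT, rfl⟩
    refine Ideal.subset_span ⟨_, ⟨T, mem_compl_circuits.1 hT, fun v hv => ?_⟩, (hprod T).symm⟩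
    have hvC := (mem_compl_circuits.1 hT).1 hv
    refine Finset.mem_map.2 ⟨⟨v, hvC⟩, ?_, rfl⟩
    rw [Finsupp.mem_support_iff, Finsupp.finsetSum_apply]
    refine (Nat.lt_of_lt_of_le Nat.one_pos (le_trans ?_ (Finset.single_le_sum
      (fun _ _ => Nat.zero_le _) (Finset.mem_subtype.2 hv : (⟨v, hvC⟩ : {v // v ∈ C.verts}) ∈ _)))).ne'
    simp
  · rintro _ ⟨m, ⟨T, hT, hTm⟩, rfl⟩
    refine Ideal.mem_of_dvd _ ?_ (Ideal.subset_span ⟨T, mem_compl_circuits.2 hT, rfl⟩)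
    rw [hprod, MvPolynomial.monomial_dvd_monomial]
    refine ⟨Or.inr fun v => ?_, dvd_rfl⟩
    rw [Finsupp.finsetSum_apply]
    by_cases hv : v ∈ T.subtype (fun v => v ∈ C.verts)
    · rw [Finset.sum_eq_single_of_mem v hv fun w _ hwv => Finsupp.single_eq_of_ne' hwv,
        Finsupp.single_eq_same]
      obtain ⟨w, hw, hwv⟩ := Finset.mem_map.1 (hTm (Finset.mem_subtype.1 hv))
      rw [← Subtype.ext hwv]
      exact Nat.one_le_iff_ne_zero.2 (Finsupp.mem_support_iff.1 hw)
    · rw [Finset.sum_eq_zero fun w hw => Finsupp.single_eq_of_ne' (by rintro rfl; exact hv hw)]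
      exact Nat.zero_le _

end UniformClutter

end SquareFree

/-! ### The minimal resolution, regularity and initial degree -/

namespace GradedPolyModule

variable {σ : Type u} {K : Type v} [Field K]

/-- The iterated syzygy modules of a module with a linear resolution starting in degree `d`. -/
noncomputable def iterSyz (M : GradedPolyModule σ K) (d : ℕ) : ℕ → GradedPolyModule σ K
  | 0 => M
  | i + 1 => (iterSyz M d i).syz (d + i)

theorem IsLinear.iterSyz {M : GradedPolyModule σ K} {d : ℕ} (h : IsLinear d M) (i : ℕ) :
    IsLinear (d + i) (M.iterSyz d i) := by
  induction i with
  | zero => exact h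
  | succ i ih => exact fun k => (ih (k + 1)).2

theorem finite_range_homogeneousComponent [Finite σ] (n : ℕ) :
    Module.Finite K (LinearMap.range
      (MvPolynomial.homogeneousComponent n : MvPolynomial σ K →ₗ[K] MvPolynomial σ K)) := by
  have : Module.Finite K (MvPolynomial.homogeneousSubmodule σ K n) :=
    Module.Finite.iff_fg.2 (MvPolynomial.homogeneousSubmodule_fg σ K n)
  refine Submodule.finiteDimensional_of_le (S₂ := MvPolynomial.homogeneousSubmodule σ K n) ?_
  rintro _ ⟨f, rfl⟩
  exact MvPolynomial.homogeneousComponent_mem n f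

/-- Syzygies of degree d + 1 lie in the image of S_1 ⊗ M_d, which is finite dimensional. -/
theorem finite_piece_syz [Finite σ] (M : GradedPolyModule σ K) (d : ℕ)
    [Module.Finite K (M.piece d)] : Module.Finite K ((M.syz d).piece (d + 1)) := by
  let c : MvPolynomial σ K →ₗ[K] MvPolynomial σ K := MvPolynomial.homogeneousComponent 1
  have : Module.Finite K (LinearMap.range c) := finite_range_homogeneousComponent 1
  let R := LinearMap.range (LinearMap.rTensor (M.piece d) (LinearMap.range c).subtype)
  have hR (t : (M.syz d).piece (d + 1)) : t.1.1 ∈ R := by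
    have h : freeProj (M.piece d) d (d + 1) t.1.1 = t.1.1 :=
      congrArg Subtype.val (mem_piece.1 t.2)
    rw [freeProj, if_pos (Nat.le_succ d), Nat.add_sub_cancel_left] at h
    refine ⟨LinearMap.rTensor (M.piece d) c.rangeRestrict t.1.1, ?_⟩
    rw [← LinearMap.rTensor_comp_apply]
    exact h
  have hfin : Module.Finite K R := Module.Finite.range _
  have : IsNoetherian K R := isNoetherian_of_isNoetherianRing_of_finite K R
  let ι : (M.syz d).piece (d + 1) →ₗ[K] R :=
    LinearMap.codRestrict R ((LinearMap.ker (M.mulMap d)).subtype.restrictScalars K ∘ₗ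
      ((M.syz d).piece (d + 1)).subtype) hR
  exact Module.Finite.of_injective ι fun x y h => by
    have h' : (ι x).1 = (ι y).1 := by rw [h]
    exact Subtype.ext (Subtype.ext h')

theorem finite_piece_iterSyz [Finite σ] (M : GradedPolyModule σ K) (d : ℕ)
    (h : Module.Finite K (M.piece d)) (i : ℕ) :
    Module.Finite K ((M.iterSyz d i).piece (d + i)) := by
  induction i with
  | zero => exact h
  | succ i ih => exact finite_piece_syz _ _

theorem finite_piece_ofExponents [Finite σ] (P : Set (σ →₀ ℕ)) (d : ℕ) :
    Module.Finite K ((ofExponents K P).piece d) := by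
  have : Module.Finite K (MvPolynomial.homogeneousSubmodule σ K d) :=
    Module.Finite.iff_fg.2 (MvPolynomial.homogeneousSubmodule_fg σ K d)
  let ι : (ofExponents K P).piece d →ₗ[K] MvPolynomial.homogeneousSubmodule σ K d :=
    LinearMap.codRestrict _ ((exponentIdeal K P).subtype.restrictScalars K ∘ₗ
      ((ofExponents K P).piece d).subtype) fun f => mem_piece_ofExponents.1 f.2
  exact Module.Finite.of_injective ι fun x y h => by
    have h' : (ι x).1 = (ι y).1 := by rw [h]
    exact Subtype.ext (Subtype.ext h')

section Coordinates

variable (M : GradedPolyModule σ K) (d : ℕ)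

/-- Coordinates on `S ⊗ M_d` with respect to a basis of `M_d`. -/
noncomputable def coords [Module.Finite K (M.piece d)] :
    MvPolynomial σ K ⊗[K] M.piece d ≃ₗ[MvPolynomial σ K]
      (Fin (Module.finrank K (M.piece d)) →₀ MvPolynomial σ K) :=
  ((Module.finBasis K (M.piece d)).baseChange (MvPolynomial σ K)).repr

variable [Module.Finite K (M.piece d)]

theorem coords_symm_single (b : Fin (Module.finrank K (M.piece d))) :
    (M.coords d).symm (Finsupp.single b 1) = 1 ⊗ₜ Module.finBasis K (M.piece d) b := by
  rw [coords, Module.Basis.repr_symm_single_one, Module.Basis.baseChange_apply]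

theorem coords_freeProj (j : ℕ) (t : MvPolynomial σ K ⊗[K] M.piece d)
    (c : Fin (Module.finrank K (M.piece d))) :
    M.coords d (freeProj _ d (d + j) t) c =
      MvPolynomial.homogeneousComponent j (M.coords d t c) := by
  induction t with
  | zero => simp
  | add x y hx hy => simp only [map_add, Finsupp.add_apply, hx, hy]
  | tmul s v =>
    rw [freeProj_tmul, if_pos (Nat.le_add_right d j), Nat.add_sub_cancel_left, coords,
      Module.Basis.baseChange_repr_tmul, Module.Basis.baseChange_repr_tmul, map_smul]

/-- The surjection from a finite free module onto a module generated in degree `d`. -/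
noncomputable def cover :
    (Fin (Module.finrank K (M.piece d)) →₀ MvPolynomial σ K) →ₗ[MvPolynomial σ K] M :=
  M.mulMap d ∘ₗ (M.coords d).symm.toLinearMap

theorem cover_single (b : Fin (Module.finrank K (M.piece d))) :
    M.cover d (Finsupp.single b 1) = Module.finBasis K (M.piece d) b := by
  change M.mulMap d ((M.coords d).symm _) = _
  rw [coords_symm_single, mulMap_tmul, one_smul]

variable {M d}

theorem cover_surjective (h : M.IsGeneratedIn d) : Function.Surjective (M.cover d) :=
  h.comp (M.coords d).symm.surjective

variable (M d)

/-- The inclusion of the syzygies in a finite free module. -/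
noncomputable def syzIncl :
    M.syz d →ₗ[MvPolynomial σ K] (Fin (Module.finrank K (M.piece d)) →₀ MvPolynomial σ K) :=
  (M.coords d).toLinearMap ∘ₗ (LinearMap.ker (M.mulMap d)).subtype

theorem syzIncl_injective : Function.Injective (M.syzIncl d) :=
  (M.coords d).injective.comp Subtype.val_injective

theorem syzIncl_cover_exact : Function.Exact (M.syzIncl d) (M.cover d) := fun y => by
  constructor
  · intro hy
    exact ⟨⟨(M.coords d).symm y, hy⟩, (M.coords d).apply_symm_apply y⟩
  · rintro ⟨x, rfl⟩
    change M.mulMap d ((M.coords d).symm (M.coords d x.1)) = 0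
    rw [LinearEquiv.symm_apply_apply]
    exact x.2

theorem isHomogeneous_syzIncl {x : M.syz d} (hx : x ∈ (M.syz d).piece (d + 1))
    (c : Fin (Module.finrank K (M.piece d))) : (M.syzIncl d x c).IsHomogeneous 1 := by
  have h : freeProj (M.piece d) d (d + 1) x.1 = x.1 := congrArg Subtype.val (mem_piece.1 hx)
  have h' := M.coords_freeProj d 1 x.1 c
  rw [h] at h'
  change (M.coords d x.1 c).IsHomogeneous 1
  rw [h']
  exact MvPolynomial.homogeneousComponent_isHomogeneous _ _

/-- The differential between the finite free modules that cover `M` and its syzygies. -/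
noncomputable def freeDiff [Module.Finite K ((M.syz d).piece (d + 1))] :
    (Fin (Module.finrank K ((M.syz d).piece (d + 1))) →₀ MvPolynomial σ K)
      →ₗ[MvPolynomial σ K] (Fin (Module.finrank K (M.piece d)) →₀ MvPolynomial σ K) :=
  M.syzIncl d ∘ₗ (M.syz d).cover (d + 1)

section

variable [Module.Finite K ((M.syz d).piece (d + 1))]

theorem isHomogeneous_freeDiff (b : Fin (Module.finrank K ((M.syz d).piece (d + 1))))
    (c : Fin (Module.finrank K (M.piece d))) :
    (M.freeDiff d (Finsupp.single b 1) c).IsHomogeneous 1 := by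
  rw [freeDiff, LinearMap.comp_apply, cover_single]
  exact isHomogeneous_syzIncl M d (Subtype.prop _) c

/-- The matrix entries are linear forms, so every coordinate of the image has zero constant term. -/
theorem constantCoeff_freeDiff
    (x : Fin (Module.finrank K ((M.syz d).piece (d + 1))) →₀ MvPolynomial σ K)
    (c : Fin (Module.finrank K (M.piece d))) :
    MvPolynomial.constantCoeff (M.freeDiff d x c) = 0 := by
  induction x using Finsupp.induction_linear with
  | zero => rw [map_zero, Finsupp.zero_apply, map_zero]
  | add x y hx hy => rw [map_add, Finsupp.add_apply, map_add, hx, hy, add_zero]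
  | single b s =>
    rw [← mul_one s, ← smul_eq_mul, ← Finsupp.smul_single, map_smul, Finsupp.smul_apply,
      smul_eq_mul, map_mul]
    have h0 := (M.isHomogeneous_freeDiff d b c).coeff_eq_zero (d := 0) (by simp)
    rw [← MvPolynomial.constantCoeff_eq] at h0
    rw [h0, mul_zero]

end

end Coordinates

/-- Splices short exact sequences: a surjection in front keeps the range, an injection behind keeps
the kernel. -/
theorem exact_comp {R A B C D E : Type*} [Ring R] [AddCommGroup A] [AddCommGroup B]
    [AddCommGroup C] [AddCommGroup D] [AddCommGroup E] [Module R A] [Module R B] [Module R C]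
    [Module R D] [Module R E] {p : A →ₗ[R] B} {i : B →ₗ[R] C} {q : C →ₗ[R] D} {j : D →ₗ[R] E}
    (hp : Function.Surjective p) (h : Function.Exact i q) (hj : Function.Injective j) :
    Function.Exact (i ∘ₗ p) (j ∘ₗ q) := fun y => by
  rw [LinearMap.comp_apply, map_eq_zero_iff j hj, h y]
  exact ⟨fun ⟨x, hx⟩ => (hp x).imp fun a ha => by rw [LinearMap.comp_apply, ha, hx],
    fun ⟨a, ha⟩ => ⟨p a, ha⟩⟩

/-- The inclusion of a monomial ideal in the polynomial ring. -/
noncomputable def inclusionRing (K : Type v) [Field K] (P : Set (σ →₀ ℕ)) :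
    ofExponents K P →ₗ[MvPolynomial σ K] MvPolynomial σ K :=
  (exponentIdeal K P).subtype

theorem inclusionRing_injective (P : Set (σ →₀ ℕ)) : Function.Injective (inclusionRing K P) :=
  Subtype.val_injective

theorem range_inclusionRing (P : Set (σ →₀ ℕ)) :
    LinearMap.range (inclusionRing K P) = exponentIdeal K P :=
  Submodule.range_subtype _

theorem isHomogeneous_inclusionRing_cover (P : Set (σ →₀ ℕ)) (d : ℕ)
    [Module.Finite K ((ofExponents K P).piece d)]
    (b : Fin (Module.finrank K ((ofExponents K P).piece d))) :
    ((inclusionRing K P ∘ₗ (ofExponents K P).cover d) (Finsupp.single b 1)).IsHomogeneous d := by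
  rw [LinearMap.comp_apply, cover_single]
  exact mem_piece_ofExponents.1 (Subtype.prop _)

/-- The minimal graded free resolution of a monomial ideal with a linear resolution. -/
noncomputable def linearResolution [Finite σ] (P : Set (σ →₀ ℕ)) {d : ℕ}
    (h : IsLinear d (ofExponents K P)) : MinimalGradedFreeResolution (exponentIdeal K P) :=
  have hfin (i : ℕ) : Module.Finite K (((ofExponents K P).iterSyz d i).piece (d + i)) :=
    finite_piece_iterSyz _ _ (finite_piece_ofExponents P d) i
  have hsurj (i : ℕ) : Function.Surjective (((ofExponents K P).iterSyz d i).cover (d + i)) :=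
    cover_surjective (h.iterSyz i 0).isGeneratedIn
  have _ : Module.Finite K ((ofExponents K P).piece d) := hfin 0
  have _ (i : ℕ) :
      Module.Finite K ((((ofExponents K P).iterSyz d i).syz (d + i)).piece (d + i + 1)) :=
    hfin (i + 1)
  { ι := fun i => Fin (Module.finrank K (((ofExponents K P).iterSyz d i).piece (d + i)))
    finite := fun _ => inferInstance
    deg := fun i _ => d + i
    aug := inclusionRing K P ∘ₗ (ofExponents K P).cover d
    diff := fun i => ((ofExponents K P).iterSyz d i).freeDiff (d + i)
    aug_graded := fun b => isHomogeneous_inclusionRing_cover P d b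
    diff_graded := fun i b c => Or.inr
      ⟨1, add_comm 1 (d + i), isHomogeneous_freeDiff _ _ b c⟩
    range_aug := (LinearMap.range_comp_of_range_eq_top _
      (LinearMap.range_eq_top.2 (hsurj 0))).trans (range_inclusionRing P)
    exact_zero := exact_comp (hsurj 1) (syzIncl_cover_exact _ _) (inclusionRing_injective P)
    exact_succ := fun i =>
      exact_comp (hsurj (i + 2)) (syzIncl_cover_exact _ _) (syzIncl_injective _ _)
    minimal := fun _ x c => constantCoeff_freeDiff _ _ x c }

theorem exists_ne_zero_of_isGeneratedIn {P : Set (σ →₀ ℕ)} {d : ℕ}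
    (h : (ofExponents K P).IsGeneratedIn d) (hP : exponentIdeal K P ≠ ⊥) :
    ∃ v : (ofExponents K P).piece d, v ≠ 0 := by
  by_contra! h0
  have : Subsingleton ((ofExponents K P).piece d) := ⟨fun x y => by rw [h0 x, h0 y]⟩
  refine hP ((Submodule.eq_bot_iff _).2 fun f hf => ?_)
  obtain ⟨t, ht⟩ := h ⟨f, hf⟩
  rw [Subsingleton.elim t 0, map_zero] at ht
  exact (congrArg Subtype.val ht).symm

theorem hasInitialDegree {P : Set (σ →₀ ℕ)} {d : ℕ} (h : (ofExponents K P).IsGeneratedIn d)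
    (hP : exponentIdeal K P ≠ ⊥) : HasInitialDegree (exponentIdeal K P) d := by
  constructor
  · obtain ⟨v, hv⟩ := exists_ne_zero_of_isGeneratedIn h hP
    exact ⟨v.1.1, v.1.2, fun h0 => hv (Subtype.ext (Subtype.ext h0)),
      mem_piece_ofExponents.1 v.2⟩
  · rintro j ⟨f, hf, hf0, hfj⟩
    by_contra! hj
    refine hf0 ((MvPolynomial.homogeneousComponent_eq_self hfj).symm.trans ?_)
    exact congrArg Subtype.val (h.proj_eq_zero hj ⟨f, hf⟩)

theorem hasRegularity [Finite σ] {P : Set (σ →₀ ℕ)} {d : ℕ} (h : IsLinear d (ofExponents K P))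
    (hP : exponentIdeal K P ≠ ⊥) : HasRegularity (exponentIdeal K P) d := by
  refine ⟨linearResolution P h, ?_⟩
  have hset : {m : ℤ | ∃ i j : ℕ, (linearResolution P h).betti i j ≠ 0 ∧
      m = (j : ℤ) - (i : ℤ)} = {(d : ℤ)} := by
    ext m
    constructor
    · rintro ⟨i, j, hij, rfl⟩
      obtain ⟨⟨b, hb⟩⟩ := (Nat.card_ne_zero.1 hij).1
      have hb' : d + i = j := hb
      rw [Set.mem_singleton_iff, ← hb']
      push_cast
      ring
    · rintro rfl
      -- Every generator of step i has degree d + i, so only the difference d occurs; it does occur,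
      -- since a nonzero ideal generated in degree d has I_d ≠ 0.
      refine ⟨0, d, ?_, by simp⟩
      have := (linearResolution P h).finite 0
      refine Nat.card_ne_zero.2 ⟨?_, inferInstance⟩
      have hfin := finite_piece_ofExponents (K := K) P d
      obtain ⟨v, hv⟩ := exists_ne_zero_of_isGeneratedIn (h 0) hP
      have hpos : 0 < Module.finrank K ((ofExponents K P).piece d) :=
        Module.finrank_pos_iff_exists_ne_zero.2 ⟨v, hv⟩
      exact ⟨⟨(⟨0, hpos⟩ : Fin (Module.finrank K ((ofExponents K P).piece d))), rfl⟩⟩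
  rw [hset]
  exact isLUB_singleton

end GradedPolyModule

theorem mainTheorem10 {α : Type*} [DecidableEq α] (d : ℕ) (hd : 0 < d)
    (C : UniformClutter α d) (hC : C.IsGeneralizedChordal)
    (K : Type*) [Field K] (hI : C.circuitIdeal K ≠ ⊥) :
    HasLinearResolution (C.circuitIdeal K) d := by
  have h := hC.isLinearFamily (K := K) hd (subset_refl C.verts)
  rw [UniformClutter.circuitIdeal_eq] at hI ⊢
  exact ⟨GradedPolyModule.hasRegularity h hI,
    GradedPolyModule.hasInitialDegree (h 0).isGeneratedIn hI⟩
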